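/- All rings are commutative and noetherian, and all modules are finitely generated. An ideal $I$ of a local ring $(S,\mathfrak n)$ is called a Burch ideal if $\mathfrak n I\neq\mathfrak n(I:_S\mathfrak n)$. A local ring $(R,\mathfrak m)$ of depth $t$, with $\mathfrak m$-adic completion $\widehat R$, is called Burch if there exist a maximal $\widehat R$-regular sequence $\boldsymbol x=x_1,\dots,x_t$ in $\widehat R$, a regular local ring $S$ and a Burch ideal $I$ of $S$ such that $\widehat R/(\boldsymbol x)\cong S/I$. A full subcategory of the category $\operatorname{mod}R$ of finitely generated $R$-modules is called resolving if it contains the projective modules and is closed under direct summands, under extensions, and under kernels of surjections; here closure under extensions and kernels of surjections means that for every exact sequence $0\to A\to B\to C\to 0$ with $C$ in the subcategory, $A$ is in it if and only if $B$ is. For an $R$-module $M$, let $\operatorname{res}_RM$ be the smallest resolving subcategory of $\operatorname{mod}R$ containing $M$, and let $\Omega^nM$ be the $n$-th syzygy of $M$ in its minimal free resolution, with $\Omega^0M=M$. **Proposition.** Let $R$ be a Burch local ring of depth $t$ with residue field $k$, and let $M$ be a finitely generated $R$-module of infinite projective dimension. Then $\Omega^tk$ belongs to $\operatorname{res}_RM$.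 -/

import Mathlib

open CategoryTheory IsLocalRing

universe u

/-- An ideal `I` of a local ring `(S, 𝔫)` is a Burch ideal if `𝔫 I ≠ 𝔫 (I :_S 𝔫)`. -/
def IsBurchIdeal {S : Type u} [CommRing S] [IsLocalRing S] (I : Ideal S) : Prop :=
  maximalIdeal S * I ≠ maximalIdeal S * Submodule.colon I (maximalIdeal S : Set S)

/-- The depth of a local ring: the supremum of the lengths of the regular sequences in its
maximal ideal. -/
noncomputable def localDepth (R : Type u) [CommRing R] [IsLocalRing R] : ℕ∞ :=
  ⨆ rs : {rs : List R //
    RingTheory.Sequence.IsRegular R rs ∧ ∀ r ∈ rs, r ∈ maximalIdeal R}, (rs.1.length : ℕ∞)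

/-- The completion of a local ring with respect to its maximal ideal. -/
abbrev LocalCompletion (R : Type u) [CommRing R] [IsLocalRing R] : Type u :=
  AdicCompletion (maximalIdeal R) R

/-- A local ring `R` of depth `t` is Burch if there are a maximal regular sequence
`x = x₁, …, x_t` in the completion `R̂`, a regular local ring `S` and a Burch ideal `I` of `S`
such that `R̂ / (x) ≅ S / I`.  (A sequence `xs` with `IsRegular R̂ xs` has all its members in the
maximal ideal of `R̂`, since `R̂ / (xs) ≠ 0`.) -/
def IsBurchRing (R : Type u) [CommRing R] [IsLocalRing R] : Prop :=
  ∃ xs : List (LocalCompletion R),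
    RingTheory.Sequence.IsRegular (LocalCompletion R) xs ∧
    (∀ y : LocalCompletion R, ¬ RingTheory.Sequence.IsRegular (LocalCompletion R) (xs ++ [y])) ∧
    (xs.length : ℕ∞) = localDepth R ∧
    ∃ (S : Type u) (_ : CommRing S) (_ : IsRegularLocalRing S) (I : Ideal S),
      IsBurchIdeal I ∧ Nonempty ((LocalCompletion R ⧸ Ideal.ofList xs) ≃+* (S ⧸ I))

/-- The first syzygy `Ω M`: the kernel of the map onto `M` from the free module on a generating
set of `M` of minimum cardinality. Over a noetherian local ring, and for `M` finitely generated,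
this is the first step of the minimal free resolution of `M`. -/
noncomputable def syzygyOne {R : Type u} [CommRing R] (M : ModuleCat.{u} R) : ModuleCat.{u} R :=
  ModuleCat.of R (LinearMap.ker (Finsupp.linearCombination R
    (Subtype.val : (⊤ : Submodule R M).generators → M)))

/-- The `n`-th syzygy `Ωⁿ M` in the minimal free resolution of `M`. -/
noncomputable def syzygy {R : Type u} [CommRing R] (n : ℕ) (M : ModuleCat.{u} R) :
    ModuleCat.{u} R :=
  syzygyOne^[n] M

/-- A resolving subcategory of the category `mod R` of finitely generated `R`-modules, given as a
property of objects of `ModuleCat R`. It is closed under isomorphisms by `of_summand`. -/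
structure IsResolving {R : Type u} [CommRing R] (X : ObjectProperty (ModuleCat.{u} R)) :
    Prop where
  /-- `X` is a subcategory of `mod R`. -/
  finite (M : ModuleCat.{u} R) (hM : X M) : Module.Finite R M
  /-- `X` contains the finitely generated projective modules. -/
  of_projective (P : ModuleCat.{u} R) (hfin : Module.Finite R P) (hP : Module.Projective R P) : X P
  /-- `X` is closed under direct summands. -/
  of_summand (M N : ModuleCat.{u} R) (i : N →ₗ[R] M) (p : M →ₗ[R] N)
    (hpi : p ∘ₗ i = LinearMap.id) (hM : X M) : X N
  /-- `X` is closed under extensions. -/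
  of_extension (L M N : ModuleCat.{u} R) (hfin : Module.Finite R M)
    (f : L →ₗ[R] M) (g : M →ₗ[R] N) (hf : Function.Injective f) (hfg : Function.Exact f g)
    (hg : Function.Surjective g) (hL : X L) (hN : X N) : X M
  /-- `X` is closed under kernels of surjections. -/
  of_kernel (L M N : ModuleCat.{u} R) (hfin : Module.Finite R L)
    (f : L →ₗ[R] M) (g : M →ₗ[R] N) (hf : Function.Injective f) (hfg : Function.Exact f g)
    (hg : Function.Surjective g) (hM : X M) (hN : X N) : X L

/-- The resolving closure `res_R C`: the smallest resolving subcategory of `mod R` that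
contains `C`. -/
def resolvingClosure {R : Type u} [CommRing R] (C : ModuleCat.{u} R) :
    ObjectProperty (ModuleCat.{u} R) :=
  fun N => ∀ X : ObjectProperty (ModuleCat.{u} R), IsResolving X → X C → X N

/-! Let `Q` be the completion of `R`, with `Q/(xs) ≅ S/I`. Taking `t` syzygies turns `M` into a
module `N` of the resolving subcategory which is still not projective and such that `xs` is regular
on `Q ⊗ N`. The Burch condition gives `a` with `𝔫 a ⊆ I` and `r ∈ 𝔫` with `r a ∉ 𝔫 I`; as errors in
`𝔫²` do no harm, `r` can be taken from `R`.

Cover `N` and its first two syzygies `K`, `L` by free modules `F`, `G`, `H`, the first two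
minimally. Up to sign, `r` times the class of `0 → L' → H → L → 0` is represented by the kernel `W`
of `(h, g) ↦ (π₂ h + r g, π₁ g)`, which lies in the subcategory. Modulo `xs`, `a` times a basis
vector `e` of `G` lifts to an element `w` of `Q ⊗ W` (`exists_baseChange_ker_twistMap`), and `w` is
killed by the maximal ideal modulo `xs`. The `e`-coordinate of `π₂ h + r g` vanishes on `W`, has
coefficients in the maximal ideal, and takes the value `r` at `e`. If `w` were in `𝔪 (Q ⊗ W)`,
lifting this relation to `S` would give `r a ∈ 𝔫 I` (`sum_mul_mem_of_mem_smul`). So `k` is a direct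
summand of `Q ⊗ W` modulo `xs`.

It remains to descend to `R`, where `xs` need not live (`IsResolving.syzygy_residueField`). The last
member of `xs` is replaced by a nearby `r ∈ R` (`HasSocleGenerator.perturb`), and `W / r W` lies in
the subcategory of modules whose first syzygies belong to the given one. That subcategory is again
resolving (`isResolving_syzygyShift`), so induction on `t` applies. For `t = 0`, flatness finds the
socle generator in `W` itself. -/

namespace LocalCompletion

/-! ### The completion of a noetherian local ring: density and noetherianity. -/

variable {R : Type u} [CommRing R] [IsLocalRing R]

theorem pow_idealOfVars_le_comap_eval {n : ℕ} {x : Fin n → R} (hx : ∀ i, x i ∈ maximalIdeal R)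
    (k : ℕ) : MvPolynomial.idealOfVars (Fin n) R ^ k ≤
      (maximalIdeal R ^ k).comap (MvPolynomial.eval x) := by
  refine (Ideal.pow_right_mono (Ideal.span_le.2 ?_) k).trans
    (Ideal.le_comap_pow (K := maximalIdeal R) (MvPolynomial.eval x) k)
  rintro _ ⟨i, rfl⟩
  simpa using hx i

/-- Evaluation at `n` elements of the maximal ideal, on the completion of `R[X₁, …, Xₙ]` at the
ideal of the variables and modulo the `k`-th power of the maximal ideal. -/
noncomputable def evalModPow {n : ℕ} {x : Fin n → R} (hx : ∀ i, x i ∈ maximalIdeal R) (k : ℕ) :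
    AdicCompletion (MvPolynomial.idealOfVars (Fin n) R) (MvPolynomial (Fin n) R) →+*
      R ⧸ maximalIdeal R ^ k :=
  (Ideal.quotientMap _ (MvPolynomial.eval x) (pow_idealOfVars_le_comap_eval hx k)).comp
    (AdicCompletion.evalₐ (MvPolynomial.idealOfVars (Fin n) R) k).toRingHom

theorem factorPow_comp_evalModPow {n : ℕ} {x : Fin n → R} (hx : ∀ i, x i ∈ maximalIdeal R)
    {m k : ℕ} (hmk : m ≤ k) :
    (Ideal.Quotient.factorPow (maximalIdeal R) hmk).comp (evalModPow hx k) = evalModPow hx m := by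
  ext y
  obtain ⟨a, rfl⟩ := AdicCompletion.mk_surjective _ _ y
  simp only [evalModPow, RingHom.comp_apply, AlgHom.toRingHom_eq_coe, RingHom.coe_coe,
    AdicCompletion.evalₐ_mk, Ideal.quotientMap_mk]
  have h1 : Ideal.Quotient.mk (MvPolynomial.idealOfVars (Fin n) R ^ m) (a.val k) =
      Ideal.Quotient.mk _ (a.val m) := by
    rw [Ideal.Quotient.eq]
    simpa using (Submodule.Quotient.eq _).1 (a.property hmk).symm
  rw [← Ideal.quotientMap_mk (H := pow_idealOfVars_le_comap_eval hx m), ← h1,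
    Ideal.quotientMap_mk]
  rfl

/-- The ring homomorphism from the completion of `R[X₁, …, Xₙ]` at the ideal of the variables to
the completion of `R`, induced by the evaluation at `n` elements of the maximal ideal. -/
noncomputable def ofMvPolynomial {n : ℕ} {x : Fin n → R} (hx : ∀ i, x i ∈ maximalIdeal R) :
    AdicCompletion (MvPolynomial.idealOfVars (Fin n) R) (MvPolynomial (Fin n) R) →+*
      LocalCompletion R :=
  AdicCompletion.liftRingHom (maximalIdeal R) (evalModPow hx) (factorPow_comp_evalModPow hx)

theorem ofMvPolynomial_of {n : ℕ} {x : Fin n → R} (hx : ∀ i, x i ∈ maximalIdeal R)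
    (p : MvPolynomial (Fin n) R) :
    ofMvPolynomial hx (AdicCompletion.of _ _ p) =
      algebraMap R (LocalCompletion R) (MvPolynomial.eval x p) := by
  refine AdicCompletion.ext_evalₐ (I := maximalIdeal R) fun k => ?_
  rw [AdicCompletion.algebraMap_apply]
  refine (AdicCompletion.evalₐ_liftRingHom _ _ (factorPow_comp_evalModPow hx) k _).trans ?_
  simp [evalModPow]

variable [IsNoetherianRing R]

theorem exists_sub_mem_pow (q : LocalCompletion R) (n : ℕ) :
    ∃ r : R, q - algebraMap R (LocalCompletion R) r ∈ maximalIdeal (LocalCompletion R) ^ n := by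
  have hfg := (maximalIdeal R).fg_of_isNoetherianRing
  obtain ⟨r, hr⟩ := Submodule.Quotient.mk_surjective _ (AdicCompletion.eval (maximalIdeal R) R n q)
  refine ⟨r, ?_⟩
  have hmem : q - algebraMap R (LocalCompletion R) r ∈
      (AdicCompletion.eval (maximalIdeal R) R n).ker := by
    rw [LinearMap.mem_ker, map_sub, ← hr, sub_eq_zero]
    rfl
  rw [← AdicCompletion.pow_smul_top_eq_ker_eval hfg] at hmem
  rw [AdicCompletion.maximalIdeal_eq_map, ← Ideal.map_pow]
  have := Ideal.smul_top_eq_map (R := R) (S := LocalCompletion R) (maximalIdeal R ^ n)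
  rw [this] at hmem
  exact hmem

/-- The completion is a quotient of a power series ring over `R`, the variables going to generators
of the maximal ideal. By completeness of the source and separatedness of the target, surjectivity
need only be checked modulo the variables, where constants suffice. -/
instance isNoetherianRing : IsNoetherianRing (LocalCompletion R) := by
  obtain ⟨n, x, hx⟩ := Submodule.fg_iff_exists_fin_generating_family.1
    (maximalIdeal R).fg_of_isNoetherianRing
  have hxm (i) : x i ∈ maximalIdeal R := hx ▸ Submodule.subset_span ⟨i, rfl⟩
  let e := MvPowerSeries.toAdicCompletionAlgEquiv (Fin n) R
  let f : MvPowerSeries (Fin n) R →+* LocalCompletion R :=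
    (ofMvPolynomial hxm).comp e.toRingEquiv.toRingHom
  have hf (p : MvPolynomial (Fin n) R) :
      f (algebraMap _ _ p) = algebraMap R _ (MvPolynomial.eval x p) := by
    have h : e (algebraMap _ _ p) = algebraMap _ _ p := e.commutes p
    change ofMvPolynomial hxm (e (algebraMap _ _ p)) = _
    rw [h, AdicCompletion.algebraMap_apply]
    exact ofMvPolynomial_of hxm p
  have hmap : (Ideal.span (Set.range MvPowerSeries.X)).map f =
      maximalIdeal (LocalCompletion R) := by
    rw [AdicCompletion.maximalIdeal_eq_map, Ideal.map_span]
    refine .trans ?_ ((Ideal.map_span (algebraMap R (LocalCompletion R)) (Set.range x)).symm.trans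
      (congrArg (Ideal.map (algebraMap R (LocalCompletion R))) hx))
    rw [← Set.range_comp, ← Set.range_comp]
    congr 2
    ext1 i
    have := hf (MvPolynomial.X i)
    rw [MvPolynomial.eval_X] at this
    rw [Function.comp_apply, ← MvPolynomial.coe_X]
    exact this
  have : IsHausdorff ((Ideal.span (Set.range MvPowerSeries.X)).map f) (LocalCompletion R) := by
    rw [hmap]
    infer_instance
  refine isNoetherianRing_of_surjective _ _ f
    (surjective_of_mk_map_comp_surjective (I := Ideal.span (Set.range MvPowerSeries.X)) f ?_)
  intro q
  obtain ⟨q, rfl⟩ := Ideal.Quotient.mk_surjective q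
  obtain ⟨r, hr⟩ := exists_sub_mem_pow q 1
  refine ⟨algebraMap (MvPolynomial (Fin n) R) (MvPowerSeries (Fin n) R) (MvPolynomial.C r), ?_⟩
  rw [RingHom.comp_apply, hf, MvPolynomial.eval_C, eq_comm, Ideal.Quotient.eq, hmap]
  simpa using hr

end LocalCompletion

/-! ### Weakly regular sequences along short exact sequences. -/

namespace RingTheory.Sequence

open Function Submodule Pointwise

section

variable {Q : Type*} [CommRing Q] {A B C : Type*} [AddCommGroup A] [Module Q A]
  [AddCommGroup B] [Module Q B] [AddCommGroup C] [Module Q C] {f : A →ₗ[Q] B} {g : B →ₗ[Q] C}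

/-- If `0 → A → B → C → 0` is exact and `xs` is weakly regular on `C`, then
`A ∩ (xs) B = (xs) A`. -/
theorem IsWeaklyRegular.mem_smul_top_of_exact {xs : List Q} (h : IsWeaklyRegular C xs)
    (hf : Injective f) (hfg : Exact f g) (hg : Surjective g) {a : A}
    (ha : f a ∈ (Ideal.ofList xs • ⊤ : Submodule Q B)) :
    a ∈ (Ideal.ofList xs • ⊤ : Submodule Q A) := by
  -- Injectivity of `f` is encoded as exactness at `A`, to fit a four-term exact sequence.
  have h0 : Exact (0 : PUnit.{1} →ₗ[Q] A) f := by
    rwa [LinearMap.exact_zero_iff_injective]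
  have h1 := map_first_exact_on_four_term_right_exact_of_isSMulRegular_last h0 hfg hg h
  obtain ⟨z, hz⟩ := (h1 (Submodule.Quotient.mk a)).1
    (by simpa [Submodule.Quotient.mk_eq_zero] using ha)
  obtain ⟨z, rfl⟩ := Submodule.Quotient.mk_surjective _ z
  rw [mapQ_apply, LinearMap.zero_apply, Submodule.Quotient.mk_zero, eq_comm,
    Submodule.Quotient.mk_eq_zero] at hz
  exact hz

theorem _root_.QuotSMulTop.map_injective_of_isSMulRegular {y : Q} (h : IsSMulRegular C y)
    (hf : Injective f) (hfg : Exact f g) :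
    Injective (QuotSMulTop.map y f) := by
  have h0 : Exact (0 : PUnit.{1} →ₗ[Q] A) f := by
    rwa [LinearMap.exact_zero_iff_injective]
  have := QuotSMulTop.map_first_exact_on_four_term_exact_of_isSMulRegular_last h0 hfg h
  rwa [map_zero, LinearMap.exact_zero_iff_injective] at this

theorem IsWeaklyRegular.of_exact {xs : List Q} (hA : IsWeaklyRegular A xs)
    (hC : IsWeaklyRegular C xs) (hf : Injective f) (hfg : Exact f g) (hg : Surjective g) :
    IsWeaklyRegular B xs := by
  induction xs generalizing A B C with
  | nil => exact .nil _ _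
  | cons y ys ih =>
    rw [isWeaklyRegular_cons_iff] at hA hC ⊢
    exact ⟨isSMulRegular_of_range_eq_ker hf hfg.linearMap_ker_eq.symm hA.1 hC.1,
      ih hA.2 hC.2 (QuotSMulTop.map_injective_of_isSMulRegular hC.1 hf hfg)
        (QuotSMulTop.map_exact y hfg hg) (QuotSMulTop.map_surjective y hg)⟩

/-- The depth of a first syzygy exceeds the depth of the module by one, as long as the free
module allows it. -/
theorem IsWeaklyRegular.append_singleton_of_exact {ys : List Q} {x : Q}
    (hB : IsWeaklyRegular B (ys ++ [x])) (hC : IsWeaklyRegular C ys)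
    (hf : Injective f) (hfg : Exact f g) (hg : Surjective g) :
    IsWeaklyRegular A (ys ++ [x]) := by
  -- The last element only has to be regular on a submodule of `B`; regularity on `C` serves to keep
  -- `f` injective modulo the earlier elements.
  induction ys generalizing A B C with
  | nil =>
    rw [List.nil_append, isWeaklyRegular_singleton_iff] at hB ⊢
    exact hB.of_injective f hf
  | cons y ys ih =>
    rw [List.cons_append, isWeaklyRegular_cons_iff] at hB ⊢
    rw [isWeaklyRegular_cons_iff] at hC
    exact ⟨hB.1.of_injective f hf,
      ih hB.2 hC.2 (QuotSMulTop.map_injective_of_isSMulRegular hC.1 hf hfg)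
        (QuotSMulTop.map_exact y hfg hg) (QuotSMulTop.map_surjective y hg)⟩

theorem IsWeaklyRegular.of_append_left {M : Type*} [AddCommGroup M] [Module Q M]
    {xs ys : List Q} (h : IsWeaklyRegular M (xs ++ ys)) : IsWeaklyRegular M xs :=
  ((isWeaklyRegular_append_iff M xs ys).1 h).1

theorem IsWeaklyRegular.of_exact_left {xs : List Q} (hB : IsWeaklyRegular B xs)
    (hC : IsWeaklyRegular C xs) (hf : Injective f) (hfg : Exact f g) (hg : Surjective g) :
    IsWeaklyRegular A xs := by
  rcases xs.eq_nil_or_concat' with rfl | ⟨ys, x, rfl⟩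
  · exact .nil _ _
  · exact hB.append_singleton_of_exact hC.of_append_left hf hfg hg

end

/-- A weakly regular sequence on the ring is weakly regular on flat modules. -/
theorem IsWeaklyRegular.module_of_flat {Q : Type*} [CommRing Q] {M : Type*} [AddCommGroup M]
    [Module Q M] [Module.Flat Q M] {xs : List Q} (h : IsWeaklyRegular Q xs) : IsWeaklyRegular M xs :=
  ((TensorProduct.rid Q M).isWeaklyRegular_congr xs).1 (h.isWeaklyRegular_lTensor (M₂ := M))

end RingTheory.Sequence

/-! ### Stability of regular elements under small perturbations. -/

section Perturb

open RingTheory.Sequence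

variable {Q : Type*} [CommRing Q] [IsLocalRing Q] [IsNoetherianRing Q]
  {V : Type*} [AddCommGroup V] [Module Q V] [Module.Finite Q V]

/-- Elements sufficiently close to a regular element are regular. -/
theorem IsSMulRegular.exists_pow_of_sub_mem {x : Q} (hx : IsSMulRegular V x) :
    ∃ n : ℕ, ∀ x', x - x' ∈ maximalIdeal Q ^ n → IsSMulRegular V x' := by
  -- The zero divisors are the union of the finitely many associated primes, and each of these is
  -- closed in the adic topology by Krull's intersection theorem.
  have key (P : Ideal Q) (hP : P ∈ associatedPrimes Q V) :
      ∃ n : ℕ, ∀ x', x - x' ∈ maximalIdeal Q ^ n → x' ∉ P := by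
    have hxP : x ∉ P := by
      intro hxP
      have h1 := biUnion_associatedPrimes_eq_compl_regular Q (M := V)
      have h2 : x ∈ ({r : Q | IsSMulRegular V r}ᶜ : Set Q) := by
        rw [← h1]
        exact Set.mem_biUnion hP hxP
      exact h2 hx
    by_contra! hcon
    apply hxP
    rw [← Ideal.Quotient.eq_zero_iff_mem]
    refine IsHausdorff.haus (I := maximalIdeal Q) inferInstance _ fun n => ?_
    obtain ⟨x', hx', hx'P⟩ := hcon n
    rw [SModEq.zero]
    have : Ideal.Quotient.mk P x = Submodule.mkQ P (x - x') := by
      rw [map_sub, Submodule.mkQ_apply, Submodule.mkQ_apply,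
        (Submodule.Quotient.mk_eq_zero P).2 hx'P, sub_zero]
      rfl
    rw [this, ← Submodule.range_mkQ P, ← Submodule.map_top, ← Submodule.map_smul'']
    exact Submodule.mem_map_of_mem (by simpa using hx')
  choose! n hn using key
  have hfin := associatedPrimes.finite Q V
  refine ⟨hfin.toFinset.sup n, fun x' hx' => ?_⟩
  by_contra hreg
  have h1 := biUnion_associatedPrimes_eq_compl_regular Q (M := V)
  have h2 : x' ∈ ({r : Q | IsSMulRegular V r}ᶜ : Set Q) := hreg
  rw [← h1, Set.mem_iUnion₂] at h2
  obtain ⟨P, hP, hxP⟩ := h2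
  exact hn P hP x' (Ideal.pow_le_pow_right
    (Finset.le_sup (f := n) (hfin.mem_toFinset.2 hP)) hx') hxP

end Perturb

/-! ### Closure properties of resolving subcategories and Schanuel's lemma. -/

namespace IsResolving

open Function

variable {R : Type u} [CommRing R] {X : ObjectProperty (ModuleCat.{u} R)}

section

variable {A B C : Type u} [AddCommGroup A] [Module R A] [AddCommGroup B] [Module R B]
  [AddCommGroup C] [Module R C]

theorem retract (hX : IsResolving X) (i : A →ₗ[R] B) (p : B →ₗ[R] A)
    (h : ∀ a, p (i a) = a) (hB : X (.of R B)) : X (.of R A) :=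
  hX.of_summand (.of R B) (.of R A) i p (LinearMap.ext h) hB

theorem extension [Module.Finite R B] (hX : IsResolving X) {f : A →ₗ[R] B} {g : B →ₗ[R] C}
    (hf : Injective f) (hfg : Exact f g) (hg : Surjective g)
    (hA : X (.of R A)) (hC : X (.of R C)) : X (.of R B) :=
  hX.of_extension (.of R A) (.of R B) (.of R C) ‹_› f g hf hfg hg hA hC

theorem kernel [Module.Finite R A] (hX : IsResolving X) {f : A →ₗ[R] B} {g : B →ₗ[R] C}
    (hf : Injective f) (hfg : Exact f g) (hg : Surjective g)
    (hB : X (.of R B)) (hC : X (.of R C)) : X (.of R A) :=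
  hX.of_kernel (.of R A) (.of R B) (.of R C) ‹_› f g hf hfg hg hB hC

theorem projective (hX : IsResolving X) [Module.Finite R A] [Module.Projective R A] :
    X (.of R A) :=
  hX.of_projective (.of R A) ‹_› ‹_›

theorem subsingleton (hX : IsResolving X) [Subsingleton A] : X (.of R A) :=
  hX.projective

theorem ker_of_surjective [IsNoetherianRing R] [Module.Finite R B] (hX : IsResolving X)
    {g : B →ₗ[R] C} (hg : Surjective g) (hB : X (.of R B)) (hC : X (.of R C)) :
    X (.of R g.ker) :=
  hX.kernel g.ker.injective_subtype g.exact_subtype_ker_map hg hB hC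

end

variable [IsNoetherianRing R]

/-- Schanuel's lemma for resolving subcategories. -/
theorem ker_of_ker (hX : IsResolving X) {P P' N : Type u}
    [AddCommGroup P] [Module R P] [Module.Finite R P]
    [AddCommGroup P'] [Module R P'] [Module.Finite R P'] [Module.Projective R P']
    [AddCommGroup N] [Module R N] {p : P →ₗ[R] N} {p' : P' →ₗ[R] N} (hPX : X (.of R P))
    (hp : Surjective p) (hp' : Surjective p') (h : X (.of R p.ker)) : X (.of R p'.ker) := by
  -- the pullback of `p` and `p'`
  let E := (p.coprod (-p')).ker
  have hE (x : P × P') : x ∈ E ↔ p x.1 = p' x.2 := by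
    simp [E, LinearMap.mem_ker, add_neg_eq_zero]
  -- `E` is an extension of `P'` by `ker p` and also of `P` by `ker p'`. Hence `P` need only belong
  -- to `X`.
  have hEX : X (.of R E) := by
    refine hX.extension (f := (LinearMap.inl R P P' ∘ₗ p.ker.subtype).codRestrict E ?_)
      (g := LinearMap.snd R P P' ∘ₗ E.subtype) ?_ ?_ ?_ h hX.projective
    · intro x
      rw [hE]
      simp
    · intro a b hab
      have := congrArg (fun e : E => e.1.1) hab
      exact Subtype.ext this
    · rintro ⟨⟨a, b⟩, hab⟩
      rw [hE] at hab
      constructor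
      · intro (h0 : b = 0)
        subst h0
        exact ⟨⟨a, by simpa using hab⟩, Subtype.ext rfl⟩
      · rintro ⟨c, hc⟩
        exact (congrArg (fun e : E => e.1.2) hc).symm
    · intro b
      obtain ⟨a, ha⟩ := hp (p' b)
      exact ⟨⟨(a, b), (hE _).2 ha⟩, rfl⟩
  refine hX.kernel (f := (LinearMap.inr R P P' ∘ₗ p'.ker.subtype).codRestrict E ?_)
      (g := LinearMap.fst R P P' ∘ₗ E.subtype) ?_ ?_ ?_ hEX hPX
  · intro x
    rw [hE]
    simp
  · intro a b hab
    have := congrArg (fun e : E => e.1.2) hab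
    exact Subtype.ext this
  · rintro ⟨⟨a, b⟩, hab⟩
    rw [hE] at hab
    constructor
    · intro (h0 : a = 0)
      subst h0
      exact ⟨⟨b, by simpa [eq_comm] using hab⟩, Subtype.ext rfl⟩
    · rintro ⟨c, hc⟩
      exact (congrArg (fun e : E => e.1.1) hc).symm
  · intro a
    obtain ⟨b, hb⟩ := hp' (p a)
    exact ⟨⟨(a, b), (hE _).2 hb.symm⟩, rfl⟩

end IsResolving

/-! ### The resolving subcategory of modules whose first syzygies lie in a given one. -/

section Shift

open Function Pointwise

variable {R : Type u} [CommRing R]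

/-- The horseshoe lemma in degree zero. -/
theorem exists_horseshoe {L M N : Type u} [AddCommGroup L] [Module R L] [AddCommGroup M]
    [Module R M] [AddCommGroup N] [Module R N] {f : L →ₗ[R] M} {g : M →ₗ[R] N}
    (hf : Injective f) (hfg : Exact f g) (hg : Surjective g) {P P' : Type u}
    [AddCommGroup P] [Module R P] [AddCommGroup P'] [Module R P'] [Module.Projective R P']
    {p : P →ₗ[R] L} {p' : P' →ₗ[R] N} (hp : Surjective p) (hp' : Surjective p') :
    ∃ q : P × P' →ₗ[R] M, Surjective q ∧
      ∃ (i : p.ker →ₗ[R] q.ker) (j : q.ker →ₗ[R] p'.ker),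
        Injective i ∧ Exact i j ∧ Surjective j := by
  obtain ⟨s, hs⟩ := Module.projective_lifting_property g p' hg
  have hs' (a) : g (s a) = p' a := DFunLike.congr_fun hs a
  have hq (v : P × P') : ((f ∘ₗ p).coprod s) v = f (p v.1) + s v.2 := rfl
  have hgq (v : P × P') : g (((f ∘ₗ p).coprod s) v) = p' v.2 := by
    rw [hq, map_add, hfg.apply_apply_eq_zero, zero_add, hs']
  refine ⟨(f ∘ₗ p).coprod s, fun m => ?_,
    (LinearMap.inl R P P' ∘ₗ p.ker.subtype).codRestrict _ fun v => ?_,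
    (LinearMap.snd R P P' ∘ₗ Submodule.subtype _).codRestrict _ fun v => ?_,
    fun a b hab => ?_, ?_, ?_⟩
  · obtain ⟨b, hb⟩ := hp' (g m)
    obtain ⟨l, hl⟩ := (hfg (m - s b)).1 (by rw [map_sub, hs', hb, sub_self])
    obtain ⟨a, rfl⟩ := hp l
    exact ⟨(a, b), by rw [hq, hl, sub_add_cancel]⟩
  · simp
  · rw [LinearMap.mem_ker]
    refine (hgq v.1).symm.trans ?_
    rw [LinearMap.mem_ker.1 v.2, map_zero]
  · have := congrArg (fun e => e.1.1) hab
    exact Subtype.ext this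
  · rintro ⟨⟨a, b⟩, hab⟩
    constructor
    · intro h0
      have h0 : b = 0 := congrArg Subtype.val h0
      subst h0
      refine ⟨⟨a, ?_⟩, rfl⟩
      rw [LinearMap.mem_ker, hq, map_zero, add_zero] at hab
      exact hf (hab.trans (map_zero f).symm)
    · rintro ⟨c, hc⟩
      exact Subtype.ext (congrArg (fun e => e.1.2) hc).symm
  · rintro ⟨b, hb⟩
    rw [LinearMap.mem_ker] at hb
    obtain ⟨l, hl⟩ := (hfg (- s b)).1 (by rw [map_neg, hs', hb, neg_zero])
    obtain ⟨a, rfl⟩ := hp l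
    exact ⟨⟨(a, b), by rw [LinearMap.mem_ker, hq, hl, neg_add_cancel]⟩, rfl⟩

/-- The finitely generated modules all of whose first syzygies belong to `X`. -/
def syzygyShift (X : ObjectProperty (ModuleCat.{u} R)) : ObjectProperty (ModuleCat.{u} R) :=
  fun N => Module.Finite R N ∧ ∀ (n : ℕ) (p : (Fin n → R) →ₗ[R] N), Surjective p →
    X (.of R p.ker)

variable [IsNoetherianRing R] {X : ObjectProperty (ModuleCat.{u} R)}

/-- By Schanuel's lemma a single cover decides membership, so minimality never matters here. -/
theorem syzygyShift_of_ker (hX : IsResolving X) {P N : Type u} [AddCommGroup P] [Module R P]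
    [Module.Finite R P] [AddCommGroup N] [Module R N] (p : P →ₗ[R] N) (hPX : X (.of R P))
    (hp : Surjective p) (h : X (.of R p.ker)) : syzygyShift X (.of R N) :=
  ⟨Module.Finite.of_surjective p hp, fun _ _ hp' => hX.ker_of_ker hPX hp hp' h⟩

theorem ker_of_syzygyShift (hX : IsResolving X) {P N : Type u} [AddCommGroup P] [Module R P]
    [Module.Finite R P] [Module.Projective R P] [AddCommGroup N] [Module R N] (p : P →ₗ[R] N)
    (hp : Surjective p) (h : syzygyShift X (.of R N)) : X (.of R p.ker) := by
  have := h.1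
  obtain ⟨n, q, hq⟩ := Module.Finite.exists_fin' R N
  exact hX.ker_of_ker hX.projective hq hp (h.2 n q hq)

theorem syzygyOne_of_syzygyShift (hX : IsResolving X) {N : ModuleCat.{u} R}
    (h : syzygyShift X N) : X (syzygyOne N) := by
  have := h.1
  have hfg : (⊤ : Submodule R N).FG := Module.Finite.fg_top
  have := hfg.finite_generators
  have : Finite (⊤ : Submodule R N).generators := this
  refine ker_of_syzygyShift hX _ ?_ h
  rw [← LinearMap.range_eq_top, Finsupp.range_linearCombination, Subtype.range_coe_subtype]
  exact Submodule.span_generators ⊤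

theorem syzygy_succ_of_syzygyShift {X : ObjectProperty (ModuleCat.{u} R)} (hX : IsResolving X)
    {t : ℕ} {N : ModuleCat.{u} R} (h : syzygyShift X (syzygy t N)) : X (syzygy (t + 1) N) := by
  rw [syzygy, Function.iterate_succ_apply']
  exact syzygyOne_of_syzygyShift hX h

/-- `x` regular on `W` gives `0 → Ω W → Ω (W / x W) → W → 0` up to free summands. -/
theorem syzygyShift_quotSMulTop (hX : IsResolving X) {W : Type u} [AddCommGroup W] [Module R W]
    [Module.Finite R W] {x : R} (hx : IsSMulRegular W x) (hW : X (.of R W)) :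
    syzygyShift X (.of R (QuotSMulTop x W)) := by
  obtain ⟨n, p, hp⟩ := Module.Finite.exists_fin' R W
  let q := Submodule.mkQ (x • (⊤ : Submodule R W)) ∘ₗ p
  have hq : Surjective q := (Submodule.mkQ_surjective _).comp hp
  have hpk := hX.ker_of_surjective hp hX.projective hW
  have hqk (v : q.ker) : ∃ w, x • w = p v := by
    have := v.2
    rw [LinearMap.mem_ker, LinearMap.comp_apply, Submodule.mkQ_apply,
      Submodule.Quotient.mk_eq_zero] at this
    obtain ⟨w, -, hw⟩ := (Submodule.mem_smul_pointwise_iff_exists _ _ _).1 this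
    exact ⟨w, hw⟩
  choose d hd using hqk
  -- The map `p` divided by `x`. Its kernel is `ker p`, which exhibits `ker q` as an extension of
  -- `W` by a syzygy of `W`.
  let D : q.ker →ₗ[R] W :=
    { toFun := d
      map_add' := fun a b => hx (by simp only [hd, smul_add, Submodule.coe_add, map_add])
      map_smul' := fun r a => hx (by
        simp only [hd, RingHom.id_apply, smul_comm x r, Submodule.coe_smul, map_smul]) }
  have hD (v : q.ker) : x • D v = p v := hd v
  refine syzygyShift_of_ker hX q hX.projective hq ?_
  refine hX.extension (f := Submodule.inclusion (LinearMap.ker_le_ker_comp p _)) (g := D)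
    (Submodule.inclusion_injective _) (fun v => ⟨fun h0 => ?_, ?_⟩) (fun w => ?_) hpk hW
  · exact ⟨⟨v, by rw [LinearMap.mem_ker, ← hD, h0, smul_zero]⟩, rfl⟩
  · rintro ⟨v, rfl⟩
    exact hx (by simp [hD])
  · obtain ⟨v, hv⟩ := hp (x • w)
    refine ⟨⟨v, ?_⟩, hx ?_⟩
    · rw [LinearMap.mem_ker, LinearMap.comp_apply, hv, Submodule.mkQ_apply,
        Submodule.Quotient.mk_eq_zero]
      exact Submodule.smul_mem_pointwise_smul _ _ _ trivial
    · simpa only [hD] using hv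

/-- This lets the descent trade one syzygy for one regular element. Extensions and kernels follow
from the horseshoe lemma; for a summand, a cover of the complement is added, and the syzygy of the
summand becomes a retract. -/
theorem isResolving_syzygyShift (hX : IsResolving X) : IsResolving (syzygyShift X) where
  finite M hM := hM.1
  of_projective P hfin hP :=
    syzygyShift_of_ker hX (LinearMap.id : P →ₗ[R] P) hX.projective surjective_id (by
      rw [LinearMap.ker_id]
      exact hX.subsingleton)
  of_summand M N i p hpi hM := by
    have := hM.1
    have hpi' (n : N) : p (i n) = n := DFunLike.congr_fun hpi n
    have hp : Surjective p := fun n => ⟨i n, hpi' n⟩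
    have := Module.Finite.of_surjective p hp
    obtain ⟨m, a, ha⟩ := Module.Finite.exists_fin' R N
    obtain ⟨k, b, hb⟩ := Module.Finite.exists_fin' R p.ker
    have hq (v) : ((i ∘ₗ a).coprod (p.ker.subtype ∘ₗ b)) v = i (a v.1) + b v.2 := rfl
    refine syzygyShift_of_ker hX a hX.projective ha (hX.retract
      (B := ((i ∘ₗ a).coprod (p.ker.subtype ∘ₗ b)).ker)
      ((LinearMap.inl R _ _ ∘ₗ a.ker.subtype).codRestrict _ fun v => ?_)
      ((LinearMap.fst R _ _ ∘ₗ Submodule.subtype _).codRestrict _ fun v => ?_)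
      (fun v => rfl) (ker_of_syzygyShift hX _ (fun x => ?_) hM))
    · simp
    · have := congrArg p (LinearMap.mem_ker.1 v.2)
      rw [hq, map_add, hpi', LinearMap.mem_ker.1 (b v.1.2).2, add_zero, map_zero] at this
      exact this
    · obtain ⟨u, hu⟩ := ha (p x)
      obtain ⟨v, hv⟩ := hb ⟨x - i (p x), by rw [LinearMap.mem_ker, map_sub, hpi', sub_self]⟩
      exact ⟨(u, v), by rw [hq, hu, hv, add_sub_cancel]⟩
  of_extension L M N hfin f g hf hfg hg hL hN := by
    have := hL.1
    have := hN.1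
    obtain ⟨m, a, ha⟩ := Module.Finite.exists_fin' R L
    obtain ⟨k, b, hb⟩ := Module.Finite.exists_fin' R N
    obtain ⟨q, hq, i, j, hi, hij, hj⟩ := exists_horseshoe hf hfg hg ha hb
    exact syzygyShift_of_ker hX q hX.projective hq
      (hX.extension hi hij hj (hL.2 m a ha) (hN.2 k b hb))
  of_kernel L M N hfin f g hf hfg hg hM hN := by
    have := hN.1
    obtain ⟨m, a, ha⟩ := Module.Finite.exists_fin' R L
    obtain ⟨k, b, hb⟩ := Module.Finite.exists_fin' R N
    obtain ⟨q, hq, i, j, hi, hij, hj⟩ := exists_horseshoe hf hfg hg ha hb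
    exact syzygyShift_of_ker hX a hX.projective ha
      (hX.kernel hi hij hj (ker_of_syzygyShift hX q hq hM) (hN.2 k b hb))

end Shift

/-! ### Socle generators modulo a sequence. -/

open RingTheory.Sequence Submodule Pointwise TensorProduct

/-- Modulo `xs`, some minimal generator of `U` is killed by the maximal ideal; that is, the
residue field is a direct summand of `U / xs U`. -/
def HasSocleGenerator {Q : Type*} [CommRing Q] [IsLocalRing Q] (U : Type*) [AddCommGroup U]
    [Module Q U] (xs : List Q) : Prop :=
  ∃ w : U, (∀ z ∈ maximalIdeal Q, z • w ∈ (Ideal.ofList xs • ⊤ : Submodule Q U)) ∧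
    w ∉ (maximalIdeal Q • ⊤ : Submodule Q U)

section

variable {Q : Type*} [CommRing Q] {U U' : Type*} [AddCommGroup U] [Module Q U]
  [AddCommGroup U'] [Module Q U']

theorem Submodule.apply_mem_smul_top (f : U →ₗ[Q] U') {I : Ideal Q} {u : U}
    (hu : u ∈ (I • ⊤ : Submodule Q U)) : f u ∈ (I • ⊤ : Submodule Q U') :=
  smul_top_le_comap_smul_top I f hu

theorem Submodule.mem_smul_top_of_mkQ {I : Ideal Q} {N : Submodule Q U} (hN : N ≤ I • ⊤) {u : U}
    (hu : N.mkQ u ∈ (I • ⊤ : Submodule Q (U ⧸ N))) : u ∈ (I • ⊤ : Submodule Q U) := by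
  rw [← range_mkQ N, ← map_top, ← map_smul''] at hu
  obtain ⟨v, hv, hvu⟩ := hu
  have h := hN ((Submodule.Quotient.eq N).1 hvu)
  simpa using sub_mem hv h

variable [IsLocalRing Q]

theorem HasSocleGenerator.congr (e : U ≃ₗ[Q] U') {xs : List Q} (h : HasSocleGenerator U xs) :
    HasSocleGenerator U' xs := by
  obtain ⟨w, hw, hwm⟩ := h
  refine ⟨e w, fun z hz => ?_, fun hmem => hwm ?_⟩
  · rw [← map_smul]
    exact apply_mem_smul_top e.toLinearMap (hw z hz)
  · simpa using apply_mem_smul_top e.symm.toLinearMap hmem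

/-- `(ys, x')` may replace `(ys, x)` when `x'` is close to `x`. -/
theorem HasSocleGenerator.perturb {ys : List Q} {x x' : Q} (h : HasSocleGenerator U (ys ++ [x]))
    (hm : ∀ y ∈ ys ++ [x], y ∈ maximalIdeal Q) (hreg : IsWeaklyRegular U (ys ++ [x]))
    (hx' : x - x' ∈ maximalIdeal Q ^ 2) : HasSocleGenerator U (ys ++ [x']) := by
  obtain ⟨w, hw, hwm⟩ := h
  have hregx : IsSMulRegular (U ⧸ (Ideal.ofList ys • ⊤ : Submodule Q U)) x :=
    (isWeaklyRegular_singleton_iff _ x).1 ((isWeaklyRegular_append_iff U ys [x]).1 hreg).2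
  have hreg' (u : U) (hu : x • u ∈ (Ideal.ofList ys • ⊤ : Submodule Q U)) :
      u ∈ (Ideal.ofList ys • ⊤ : Submodule Q U) :=
    mem_of_isSMulRegular_quotient_of_smul_mem hregx hu
  have hys : (Ideal.ofList ys • ⊤ : Submodule Q U) ≤ maximalIdeal Q • ⊤ :=
    smul_mono_left (Ideal.span_le.2 fun y hy => hm y (List.mem_append_left _ hy))
  have hmem (y : Q) (u : U) : u ∈ (Ideal.ofList (ys ++ [y]) • ⊤ : Submodule Q U) ↔
      ∃ v, u - y • v ∈ (Ideal.ofList ys • ⊤ : Submodule Q U) := by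
    rw [Ideal.ofList_append, Ideal.ofList_singleton, sup_smul, ideal_span_singleton_smul, mem_sup]
    constructor
    · rintro ⟨a, ha, b, hb, rfl⟩
      obtain ⟨v, -, rfl⟩ := (mem_smul_pointwise_iff_exists _ _ _).1 hb
      exact ⟨v, by simpa using ha⟩
    · rintro ⟨v, hv⟩
      exact ⟨_, hv, _, smul_mem_pointwise_smul v y ⊤ trivial, by simp⟩
  -- One factor of a product in `𝔪²` moves `w` into `x U` modulo `ys`; the other one puts `v` into
  -- `𝔪 U`, so that `w - v` is still a minimal generator.
  have hsq (s : Q) (hs : s ∈ maximalIdeal Q ^ 2) :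
      ∃ v ∈ (maximalIdeal Q • ⊤ : Submodule Q U),
        s • w - x • v ∈ (Ideal.ofList ys • ⊤ : Submodule Q U) := by
    rw [pow_two] at hs
    induction hs using Submodule.mul_induction_on' with
    | mem_mul_mem a ha b hb =>
      obtain ⟨v, hv⟩ := (hmem x _).1 (hw b hb)
      refine ⟨a • v, smul_mem_smul ha trivial, ?_⟩
      have := Submodule.smul_mem _ a hv
      rwa [smul_sub, smul_smul, smul_comm] at this
    | add a _ b _ iha ihb =>
      obtain ⟨v, hv, hv'⟩ := iha
      obtain ⟨v₁, hv₁, hv₁'⟩ := ihb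
      refine ⟨v + v₁, add_mem hv hv₁, ?_⟩
      have := add_mem hv' hv₁'
      rwa [sub_add_sub_comm, ← add_smul, ← smul_add] at this
  obtain ⟨v, hv, hvs⟩ := hsq _ hx'
  refine ⟨w - v, fun z hz => ?_, fun hmem' => hwm (by simpa using add_mem hmem' hv)⟩
  obtain ⟨u, hu⟩ := (hmem x _).1 (hw z hz)
  -- The same `u` works for `x'`, after cancelling `x`, which is regular modulo `ys`.
  refine (hmem x' _).2 ⟨u, hreg' _ ?_⟩
  have h1 := Submodule.smul_mem _ x' hu
  have h2 := Submodule.smul_mem _ z hvs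
  have h3 : x • (z • (w - v) - x' • u) = x' • (z • w - x • u) + z • ((x - x') • w - x • v) := by
    module
  rw [h3]
  exact add_mem h1 h2

/-- Passage to the quotient by one element of the sequence. -/
theorem HasSocleGenerator.quotSMulTop {ys : List Q} {x : Q} (hx : x ∈ maximalIdeal Q)
    (h : HasSocleGenerator U (ys ++ [x])) : HasSocleGenerator (QuotSMulTop x U) ys := by
  obtain ⟨w, hw, hwm⟩ := h
  have hle : x • (⊤ : Submodule Q U) ≤ maximalIdeal Q • ⊤ := by
    rw [← ideal_span_singleton_smul]
    exact smul_mono_left ((Ideal.span_singleton_le_iff_mem _).2 hx)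
  refine ⟨mkQ _ w, fun z hz => ?_, fun hmem => hwm (mem_smul_top_of_mkQ hle hmem)⟩
  have h1 := hw z hz
  rw [Ideal.ofList_append, Ideal.ofList_singleton, sup_smul, ideal_span_singleton_smul,
    mem_sup] at h1
  obtain ⟨a, ha, b, hb, hab⟩ := h1
  have hb0 : mkQ (x • (⊤ : Submodule Q U)) b = 0 := (Submodule.Quotient.mk_eq_zero _).2 hb
  rw [← map_smul, ← hab, map_add, hb0, add_zero]
  exact apply_mem_smul_top _ ha

end

/-! ### Descent of socle generators from the completion. -/

section Descent

variable {R : Type u} [CommRing R] [IsLocalRing R]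

/-- A minimal generator killed by the maximal ideal splits off the residue field. -/
theorem IsResolving.residueField {X : ObjectProperty (ModuleCat.{u} R)} (hX : IsResolving X)
    {W : Type u} [AddCommGroup W] [Module R W] (hW : X (.of R W)) {n : W}
    (hn : ∀ z ∈ maximalIdeal R, z • n = 0) (hnm : n ∉ (maximalIdeal R • ⊤ : Submodule R W)) :
    X (.of R (ResidueField R)) := by
  let _ : Module (ResidueField R) (W ⧸ (maximalIdeal R • ⊤ : Submodule R W)) :=
    inferInstanceAs (Module (R ⧸ maximalIdeal R) _)
  have hn0 : mkQ (maximalIdeal R • ⊤ : Submodule R W) n ≠ 0 := by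
    rwa [Ne, mkQ_apply, Submodule.Quotient.mk_eq_zero]
  -- A functional on the vector space `W / 𝔪 W` with value `1` at `n` gives the retraction.
  obtain ⟨f, hf⟩ := Module.Projective.exists_dual_eq_one (ResidueField R) hn0
  let f' : (W ⧸ (maximalIdeal R • ⊤ : Submodule R W)) →ₗ[R] ResidueField R :=
    { toFun := f
      map_add' := map_add f
      map_smul' := fun r v => by
        have : r • v = (residue R r) • v := rfl
        rw [this, map_smul, RingHom.id_apply, smul_eq_mul, Algebra.smul_def]
        rfl }
  let i : ResidueField R →ₗ[R] W :=
    liftQ (maximalIdeal R) (LinearMap.toSpanSingleton R W n) (fun z hz => hn z hz)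
  refine hX.retract i (f' ∘ₗ mkQ _) (fun a => ?_) hW
  obtain ⟨r, rfl⟩ := residue_surjective a
  have h1 : i (residue R r) = r • n := rfl
  rw [h1, map_smul]
  have h2 : (f' ∘ₗ mkQ (maximalIdeal R • ⊤ : Submodule R W)) n = 1 := hf
  rw [h2, Algebra.smul_def, mul_one]
  rfl

theorem TensorProduct.tmul_mem_smul_top {R Q W : Type*} [CommRing R] [CommRing Q] [Algebra R Q]
    [AddCommGroup W] [Module R W] {I : Ideal R} (q : Q) {v : W}
    (hv : v ∈ (I • ⊤ : Submodule R W)) :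
    q ⊗ₜ[R] v ∈ (I.map (algebraMap R Q) • ⊤ : Submodule Q (Q ⊗[R] W)) := by
  induction hv using Submodule.smul_induction_on' with
  | smul r hr n _ =>
    rw [TensorProduct.tmul_smul, ← algebraMap_smul Q r]
    exact smul_mem_smul (Ideal.mem_map_of_mem _ hr) trivial
  | add a _ b _ ha hb =>
    rw [TensorProduct.tmul_add]
    exact add_mem ha hb

variable [IsNoetherianRing R] {Q : Type u} [CommRing Q] [Algebra R Q] [Module.Flat R Q]

/-- The elements of `Q ⊗ W` killed by the maximal ideal come from those of `W`. -/
theorem exists_socle_generator_of_baseChange [IsLocalRing Q]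
    (hm : (maximalIdeal R).map (algebraMap R Q) = maximalIdeal Q)
    {W : Type u} [AddCommGroup W] [Module R W] (h : HasSocleGenerator (Q ⊗[R] W) ([] : List Q)) :
    ∃ n : W, (∀ z ∈ maximalIdeal R, z • n = 0) ∧ n ∉ (maximalIdeal R • ⊤ : Submodule R W) := by
  obtain ⟨w, hw, hwm⟩ := h
  obtain ⟨e, x, hx⟩ := Submodule.fg_iff_exists_fin_generating_family.1
    (maximalIdeal R).fg_of_isNoetherianRing
  -- The socle is the kernel of multiplication by generators of `𝔪`, and flat base change preserves
  -- kernels.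
  let f : W →ₗ[R] (Fin e → W) := LinearMap.pi fun i => x i • LinearMap.id
  have hf (v : W) : f v = 0 ↔ ∀ z ∈ maximalIdeal R, z • v = 0 := by
    constructor
    · intro h0 z hz
      rw [← hx] at hz
      induction hz using Submodule.span_induction with
      | mem _ h =>
        obtain ⟨i, rfl⟩ := h
        exact congrFun h0 i
      | zero => exact zero_smul _ _
      | add a b _ _ ha hb => rw [add_smul, ha, hb, add_zero]
      | smul a b _ hb => rw [smul_assoc, hb, smul_zero]
    · intro h0
      exact funext fun i => h0 _ (hx ▸ subset_span ⟨i, rfl⟩)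
  have hfw : f.lTensor Q w = 0 := by
    apply (TensorProduct.piRight R Q Q (fun _ : Fin e => W)).injective
    rw [map_zero]
    ext i
    have h1 (w : Q ⊗[R] W) : (TensorProduct.piRight R Q Q (fun _ : Fin e => W))
        (f.lTensor Q w) i = algebraMap R Q (x i) • w := by
      induction w using TensorProduct.induction_on with
      | zero => simp
      | tmul q v => simp [f, TensorProduct.tmul_smul]
      | add a b ha hb => simp only [map_add, Pi.add_apply, ha, hb, smul_add]
    rw [h1]
    have := hw (algebraMap R Q (x i)) (hm ▸ Ideal.mem_map_of_mem _ (hx ▸ subset_span ⟨i, rfl⟩))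
    simpa using this
  have hex := Module.Flat.lTensor_exact Q (f.exact_subtype_ker_map)
  obtain ⟨y, rfl⟩ := (hex w).1 hfw
  by_contra! hcon
  refine hwm ?_
  clear hwm hfw hw
  induction y using TensorProduct.induction_on with
  | zero => simp
  | tmul q v =>
    rw [← hm]
    exact tmul_mem_smul_top q (hcon v.1 ((hf _).1 v.2))
  | add a b ha hb =>
    rw [map_add]
    exact add_mem ha hb

/-- Descent along `R → Q`: if `Q ⊗ W` has the residue field as a direct summand modulo a regular
sequence of length `t`, then the `t`-th syzygy of the residue field of `R` is built from `W`. -/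
theorem IsResolving.syzygy_residueField [IsLocalRing Q] [IsNoetherianRing Q]
    (hm : (maximalIdeal R).map (algebraMap R Q) = maximalIdeal Q)
    (happ : ∀ (q : Q) (n : ℕ), ∃ r : R, q - algebraMap R Q r ∈ maximalIdeal Q ^ n)
    (t : ℕ) {X : ObjectProperty (ModuleCat.{u} R)} (hX : IsResolving X)
    {W : Type u} [AddCommGroup W] [Module R W] [Module.Finite R W] (hW : X (.of R W))
    (xs : List Q) (ht : xs.length = t) (hxs : ∀ x ∈ xs, x ∈ maximalIdeal Q)
    (hreg : IsWeaklyRegular (Q ⊗[R] W) xs) (hsoc : HasSocleGenerator (Q ⊗[R] W) xs) :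
    X (syzygy t (.of R (ResidueField R))) := by
  induction t generalizing X W xs with
  | zero =>
    rw [List.length_eq_zero_iff] at ht
    subst ht
    obtain ⟨n, hn, hnm⟩ := exists_socle_generator_of_baseChange hm hsoc
    exact hX.residueField hW hn hnm
  | succ t ih =>
    obtain ⟨ys, x, rfl⟩ := xs.eq_nil_or_concat'.resolve_left (by rintro rfl; simp at ht)
    have hreg2 := (isWeaklyRegular_append_iff _ ys [x]).1 hreg
    obtain ⟨n, hn⟩ := ((isWeaklyRegular_singleton_iff _ x).1 hreg2.2).exists_pow_of_sub_mem
    -- The exponent `n` preserves regularity, the exponent `2` preserves the socle generator.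
    obtain ⟨r, hr⟩ := happ x (max n 2)
    have hx := hxs x (by simp)
    have hr2 := Ideal.pow_le_pow_right (le_max_right n 2) hr
    have hrm : algebraMap R Q r ∈ maximalIdeal Q := by
      have := sub_mem hx (Ideal.pow_le_self two_ne_zero hr2)
      rwa [sub_sub_cancel] at this
    have hregr : IsWeaklyRegular (Q ⊗[R] W) (ys ++ [algebraMap R Q r]) :=
      (isWeaklyRegular_append_iff _ _ _).2 ⟨hreg2.1, (isWeaklyRegular_singleton_iff _ _).2
        (hn _ (Ideal.pow_le_pow_right (le_max_left n 2) hr))⟩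
    have hysm (y) (hy : y ∈ ys) : y ∈ maximalIdeal Q := hxs y (List.mem_append_left _ hy)
    -- Only `r` comes from `R`, so it is moved to the front in order to be factored out over `R`.
    have hregr' : IsWeaklyRegular (Q ⊗[R] W) (algebraMap R Q r :: ys) := by
      refine IsLocalRing.isWeaklyRegular_of_perm_of_subset_maximalIdeal hregr
        (List.perm_append_singleton _ _) fun y hy => ?_
      rcases List.mem_append.1 hy with hy | hy
      · exact hysm y hy
      · rwa [List.mem_singleton.1 hy]
    rw [isWeaklyRegular_cons_iff] at hregr'
    have hrW : IsSMulRegular W r := by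
      have : IsLocalHom (algebraMap R Q) :=
        ((IsLocalRing.local_hom_TFAE (algebraMap R Q)).out 0 2).2 hm.le
      have : Module.FaithfullyFlat R Q := Module.FaithfullyFlat.of_flat_of_isLocalHom
      have h1 : IsSMulRegular (Q ⊗[R] W) r := fun a b hab => hregr'.1 (by simpa using hab)
      exact h1.of_injective (TensorProduct.mk R Q W 1)
        (Module.FaithfullyFlat.tensorProduct_mk_injective W)
    let e := QuotSMulTop.algebraMapTensorEquivTensorQuotSMulTop r W Q
    exact syzygy_succ_of_syzygyShift hX (ih (isResolving_syzygyShift hX)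
      (syzygyShift_quotSMulTop hX hrW hW) ys (by simpa using ht) hysm
      ((e.isWeaklyRegular_congr ys).1 hregr'.2)
      (((hsoc.perturb hxs hreg hr2).quotSMulTop hrm).congr e))

end Descent

/-! ### Burch ideals and lifting relations to `S`. -/

section Burch

variable {Q S : Type u} [CommRing Q] [IsLocalRing Q] [CommRing S] [IsLocalRing S] {I : Ideal S}

theorem IsBurchIdeal.ne_top (h : IsBurchIdeal I) : I ≠ ⊤ := by
  rintro rfl
  apply h
  congr 1
  rw [eq_comm, eq_top_iff]
  exact Ideal.le_colon

theorem IsBurchIdeal.exists_mul_notMem (h : IsBurchIdeal I) :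
    ∃ r ∈ maximalIdeal S, ∃ a, (∀ z ∈ maximalIdeal S, a * z ∈ I) ∧
      r * a ∉ maximalIdeal S * I := by
  by_contra! hcon
  refine h (le_antisymm (Ideal.mul_mono_right Ideal.le_colon) (Ideal.mul_le.2 ?_))
  intro r hr a ha
  refine hcon r hr a fun z hz => ?_
  exact Submodule.mem_colon.1 ha z hz

variable {θ : Q →+* S ⧸ I}

theorem exists_lift_mem_maximalIdeal (hI : I ≠ ⊤) (hθ : Function.Surjective θ) {z : Q}
    (hz : z ∈ maximalIdeal Q) : ∃ s ∈ maximalIdeal S, Ideal.Quotient.mk I s = θ z := by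
  have : Nontrivial (S ⧸ I) := Ideal.Quotient.nontrivial_iff.2 hI
  obtain ⟨s, hs⟩ := Ideal.Quotient.mk_surjective (θ z)
  refine ⟨s, ?_, hs⟩
  have := IsLocalHom.of_surjective θ hθ
  rw [mem_maximalIdeal, mem_nonunits_iff] at hz ⊢
  intro hu
  exact hz (isUnit_of_map_unit θ z (hs ▸ hu.map _))

theorem exists_lift_mem_maximalIdeal_sq (hI : I ≠ ⊤) (hθ : Function.Surjective θ) {z : Q}
    (hz : z ∈ maximalIdeal Q ^ 2) :
    ∃ s ∈ maximalIdeal S ^ 2, Ideal.Quotient.mk I s = θ z := by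
  rw [pow_two] at hz ⊢
  induction hz using Submodule.mul_induction_on' with
  | mem_mul_mem a ha b hb =>
    obtain ⟨s, hs, hs'⟩ := exists_lift_mem_maximalIdeal hI hθ ha
    obtain ⟨t, ht, ht'⟩ := exists_lift_mem_maximalIdeal hI hθ hb
    exact ⟨s * t, Ideal.mul_mem_mul hs ht, by rw [map_mul, map_mul, hs', ht']⟩
  | add a _ b _ iha ihb =>
    obtain ⟨s, hs, hs'⟩ := iha
    obtain ⟨t, ht, ht'⟩ := ihb
    exact ⟨s + t, add_mem hs ht, by rw [map_add, map_add, hs', ht']⟩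

/-- The element `r` witnessing that `I` is Burch can be chosen in a dense subring. -/
theorem IsBurchIdeal.exists_mul_notMem_of_dense (h : IsBurchIdeal I)
    (hθ : Function.Surjective θ) {R : Type*} [CommRing R] [Algebra R Q]
    (happ : ∀ q : Q, ∃ r : R, q - algebraMap R Q r ∈ maximalIdeal Q ^ 2) :
    ∃ r : R, algebraMap R Q r ∈ maximalIdeal Q ∧ ∃ s ∈ maximalIdeal S,
      Ideal.Quotient.mk I s = θ (algebraMap R Q r) ∧
      ∃ a, (∀ z ∈ maximalIdeal S, a * z ∈ I) ∧ s * a ∉ maximalIdeal S * I := by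
  obtain ⟨s, hs, a, ha, hsa⟩ := h.exists_mul_notMem
  have : Nontrivial (S ⧸ I) := Ideal.Quotient.nontrivial_iff.2 h.ne_top
  have := IsLocalHom.of_surjective θ hθ
  obtain ⟨q, hq⟩ := hθ (Ideal.Quotient.mk I s)
  have hqm : q ∈ maximalIdeal Q := by
    rw [mem_maximalIdeal, mem_nonunits_iff]
    intro hu
    have := hu.map θ
    rw [hq] at this
    have hloc := IsLocalHom.of_surjective (Ideal.Quotient.mk I)
      Ideal.Quotient.mk_surjective
    exact hs (isUnit_of_map_unit (Ideal.Quotient.mk I) s this)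
  obtain ⟨r, hr⟩ := happ q
  obtain ⟨e, he, he'⟩ := exists_lift_mem_maximalIdeal_sq h.ne_top hθ hr
  -- This is `𝔫² a = 𝔫 (𝔫 a) ⊆ 𝔫 I`: the approximation error is invisible to the Burch condition.
  have hea : e * a ∈ maximalIdeal S * I := by
    clear he'
    rw [pow_two] at he
    induction he using Submodule.mul_induction_on' with
    | mem_mul_mem b hb c hc =>
      rw [mul_assoc, mul_comm c]
      exact Ideal.mul_mem_mul hb (ha c hc)
    | add b _ c _ ihb ihc =>
      rw [add_mul]
      exact add_mem ihb ihc
  refine ⟨r, ?_, s - e, sub_mem hs (Ideal.pow_le_self two_ne_zero he), ?_, a, ha, fun hmem => ?_⟩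
  · have := sub_mem hqm (Ideal.pow_le_self two_ne_zero hr)
    rwa [sub_sub_cancel] at this
  · rw [map_sub, ← hq, he', map_sub, sub_sub_cancel]
  · apply hsa
    have := add_mem hmem hea
    rwa [← add_mul, sub_add_cancel] at this

/-- Linear relations with coefficients `b i` in the maximal ideal, which hold on `T` modulo `I`,
lift to relations modulo `𝔫 I` on `𝔪 T`. -/
theorem sum_mul_mem_of_mem_smul (hI : I ≠ ⊤) (hθ : Function.Surjective θ) {ι : Type*} [Fintype ι]
    {b : ι → Q} {c : ι → S} (hc : ∀ i, c i ∈ maximalIdeal S)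
    (hbc : ∀ i, Ideal.Quotient.mk I (c i) = θ (b i))
    {T : Submodule Q (ι → Q)} (hT : ∀ u ∈ T, ∑ i, b i * u i = 0) {v : ι → Q}
    (hv : v ∈ maximalIdeal Q • T) {s : ι → S} (hs : ∀ i, Ideal.Quotient.mk I (s i) = θ (v i)) :
    ∑ i, c i * s i ∈ maximalIdeal S * I := by
  induction hv using Submodule.smul_induction_on' generalizing s with
  | smul z hz u hu =>
    obtain ⟨z', hz', hzz⟩ := exists_lift_mem_maximalIdeal hI hθ hz
    choose u' hu' using fun i => Ideal.Quotient.mk_surjective (θ (u i))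
    have h1 : ∑ i, c i * u' i ∈ I := by
      rw [← Ideal.Quotient.eq_zero_iff_mem, map_sum]
      simp only [map_mul, hbc, hu']
      rw [← map_zero θ, ← hT u hu, map_sum]
      simp only [map_mul]
    -- The first sum lies in `I` and gains the factor `z' ∈ 𝔫`. In the second, two lifts of the same
    -- element differ by a member of `I`, which gains the factor `c i ∈ 𝔫`.
    have h2 : ∑ i, c i * s i = z' * ∑ i, c i * u' i + ∑ i, c i * (s i - z' * u' i) := by
      rw [Finset.mul_sum, ← Finset.sum_add_distrib]
      exact Finset.sum_congr rfl fun i _ => by ring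
    rw [h2]
    refine add_mem (Ideal.mul_mem_mul hz' h1) (sum_mem fun i _ => Ideal.mul_mem_mul (hc i) ?_)
    rw [← Ideal.Quotient.eq_zero_iff_mem, map_sub, map_mul, hs, hzz, hu', Pi.smul_apply,
      smul_eq_mul, map_mul, sub_self]
  | add x _ y _ hx hy =>
    choose x' hx' using fun i => Ideal.Quotient.mk_surjective (θ (x i))
    have h1 := hx hx'
    have h2 := hy (s := fun i => s i - x' i) fun i => by
      rw [map_sub, hs, hx', Pi.add_apply, map_add, add_sub_cancel_left]
    have := add_mem h1 h2
    rw [← Finset.sum_add_distrib] at this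
    convert this using 2
    ring

end Burch

/-! ### Flat base change and minimal free covers. -/

section BaseChange

variable {R : Type*} (Q : Type*) [CommRing R] [CommRing Q] [Algebra R Q] [Module.Flat R Q]
  {A B C : Type*} [AddCommGroup A] [Module R A] [AddCommGroup B] [Module R B]
  [AddCommGroup C] [Module R C] {f : A →ₗ[R] B} {g : B →ₗ[R] C}

theorem LinearMap.baseChange_injective_of_flat (hf : Function.Injective f) :
    Function.Injective (f.baseChange Q) :=
  Module.Flat.lTensor_preserves_injective_linearMap f hf

theorem LinearMap.baseChange_exact_of_flat (hfg : Function.Exact f g) :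
    Function.Exact (f.baseChange Q) (g.baseChange Q) :=
  Module.Flat.lTensor_exact Q hfg

theorem Submodule.exists_mem_smul_top_of_surjective {f : A →ₗ[R] B} (hf : Function.Surjective f)
    {I : Ideal R} {b : B} (hb : b ∈ (I • ⊤ : Submodule R B)) :
    ∃ a ∈ (I • ⊤ : Submodule R A), f a = b := by
  rwa [← LinearMap.range_eq_top.2 hf, ← map_top, ← map_smul''] at hb

end BaseChange

section MinimalCover

variable {R : Type*} [CommRing R] [IsLocalRing R]

theorem exists_minimal_fin_cover (N : Type*) [AddCommGroup N] [Module R N] [Module.Finite R N] :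
    ∃ (n : ℕ) (p : (Fin n → R) →ₗ[R] N), Function.Surjective p ∧
      ∀ v, p v = 0 → ∀ i, v i ∈ maximalIdeal R := by
  classical
  let P (n : ℕ) : Prop := ∃ p : (Fin n → R) →ₗ[R] N, Function.Surjective p
  have hP : ∃ n, P n := Module.Finite.exists_fin' R N
  obtain ⟨p, hp⟩ := Nat.find_spec hP
  refine ⟨Nat.find hP, p, hp, fun v hv i => ?_⟩
  by_contra hi
  generalize hn : Nat.find hP = n at p hp v hv i hi
  cases n with
  | zero => exact i.elim0
  | succ m =>
    have hu : IsUnit (v i) := by simpa using hi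
    obtain ⟨w, hw⟩ := hu.exists_left_inv
    -- A relation with a unit as `i`-th coefficient makes the `i`-th generator redundant, against
    -- the minimality of the rank.
    refine Nat.find_min hP (m := m) (by omega) ?_
    refine ⟨p ∘ₗ LinearMap.pi fun j => (i.insertNth (α := fun _ => (Fin m → R) →ₗ[R] R) 0
      (fun k => LinearMap.proj k) j : (Fin m → R) →ₗ[R] R), fun y => ?_⟩
    obtain ⟨u, rfl⟩ := hp y
    refine ⟨fun k => u (i.succAbove k) - u i * w * v (i.succAbove k), ?_⟩
    have : p u = p (u - (u i * w) • v) := by simp [hv]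
    rw [this, LinearMap.comp_apply]
    congr 1
    ext j
    rw [LinearMap.pi_apply]
    refine Fin.succAboveCases i ?_ (fun k => ?_) j
    · simp [mul_assoc, hw]
    · simp

/-- Every finitely generated module over a local ring has a minimal free cover. -/
theorem exists_minimal_cover {R : Type u} [CommRing R] [IsLocalRing R] (N : Type u)
    [AddCommGroup N] [Module R N] [Module.Finite R N] :
    ∃ (F : Type u) (_ : AddCommGroup F) (_ : Module R F) (n : ℕ) (B : Module.Basis (Fin n) R F)
      (p : F →ₗ[R] N), Function.Surjective p ∧
        ∀ v, p v = 0 → ∀ i, B.repr v i ∈ maximalIdeal R := by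
  obtain ⟨n, p, hp, hmin⟩ := exists_minimal_fin_cover (R := R) N
  exact ⟨Fin n → R, _, _, n, Pi.basisFun R (Fin n), p, hp, by simpa using hmin⟩

theorem Module.Basis.mem_smul_top_of_repr_mem {R F ι : Type*} [CommRing R] [AddCommGroup F]
    [Module R F] [Fintype ι] (B : Module.Basis ι R F) {J : Ideal R} {v : F}
    (hv : ∀ i, B.repr v i ∈ J) : v ∈ (J • ⊤ : Submodule R F) := by
  rw [← B.sum_repr v]
  exact sum_mem fun i _ => smul_mem_smul (hv i) trivial

end MinimalCover

/-! ### The multiple of an extension class by a ring element. -/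

section Extension

variable {R : Type u} [CommRing R] {H G K : Type u} [AddCommGroup H] [Module R H]
  [AddCommGroup G] [Module R G] [AddCommGroup K] [Module R K] (π₁ : G →ₗ[R] K)
  (π₂ : H →ₗ[R] π₁.ker) (r : R)

/-- For `G → K` with kernel `L` and `H → L`, the map `H × G → G × K` whose kernel is the extension
of `L` by the kernel of `H → L` with `r` times the class of `0 → ker → H → L → 0`. -/
def twistMap : H × G →ₗ[R] G × K :=
  (LinearMap.inl R G K ∘ₗ π₁.ker.subtype ∘ₗ π₂).coprod
    (LinearMap.inl R G K ∘ₗ (r • LinearMap.id) + LinearMap.inr R G K ∘ₗ π₁)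

theorem twistMap_apply (v : H × G) :
    twistMap π₁ π₂ r v = ((π₂ v.1 : G) + r • v.2, π₁ v.2) := by
  simp [twistMap]

variable {π₁ π₂ r}

theorem mem_ker_twistMap {v : H × G} :
    v ∈ (twistMap π₁ π₂ r).ker ↔ (π₂ v.1 : G) + r • v.2 = 0 ∧ π₁ v.2 = 0 := by
  rw [LinearMap.mem_ker, twistMap_apply, Prod.mk_eq_zero]

theorem IsResolving.ker_twistMap {X : ObjectProperty (ModuleCat.{u} R)} (hX : IsResolving X)
    [IsNoetherianRing R] [Module.Finite R H] [Module.Finite R G]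
    (h₂ : Function.Surjective π₂) (hL : X (.of R π₁.ker)) (hL' : X (.of R π₂.ker)) :
    X (.of R (twistMap π₁ π₂ r).ker) := by
  refine hX.extension
    (f := (LinearMap.inl R H G ∘ₗ π₂.ker.subtype).codRestrict _ fun v => ?_)
    (g := (LinearMap.snd R H G ∘ₗ Submodule.subtype _).codRestrict _ fun v => ?_)
    (fun a b hab => ?_) (fun v => ⟨fun h0 => ?_, ?_⟩) (fun l => ?_) hL' hL
  · rw [mem_ker_twistMap]
    simp
  · exact (mem_ker_twistMap.1 v.2).2
  · exact Subtype.ext (congrArg (fun e => e.1.1) hab)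
  · obtain ⟨⟨a, b⟩, hab⟩ := v
    have h0 : b = 0 := congrArg Subtype.val h0
    subst h0
    refine ⟨⟨a, ?_⟩, rfl⟩
    simpa using (mem_ker_twistMap.1 hab).1
  · rintro ⟨c, rfl⟩
    rfl
  · obtain ⟨a, ha⟩ := h₂ (-(r • l))
    exact ⟨⟨(a, l), mem_ker_twistMap.2 ⟨by rw [ha]; simp, l.2⟩⟩, rfl⟩

variable (π₁ π₂ r) in
/-- The image of `twistMap` is an extension of `K` by `L`. -/
theorem exists_exact_range_twistMap (h₁ : Function.Surjective π₁) (h₂ : Function.Surjective π₂) :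
    ∃ (f : π₁.ker →ₗ[R] (twistMap π₁ π₂ r).range) (g : (twistMap π₁ π₂ r).range →ₗ[R] K),
      Function.Injective f ∧ Function.Exact f g ∧ Function.Surjective g := by
  refine ⟨(LinearMap.inl R G K ∘ₗ π₁.ker.subtype).codRestrict _ fun l => ?_,
    LinearMap.snd R G K ∘ₗ Submodule.subtype _, fun a b hab => ?_, fun v => ⟨fun h0 => ?_, ?_⟩,
    fun y => ?_⟩
  · obtain ⟨a, ha⟩ := h₂ l
    exact ⟨(a, 0), by simp [twistMap_apply, ha]⟩
  · exact Subtype.ext (congrArg (fun e => e.1.1) hab)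
  · obtain ⟨_, ⟨a, b⟩, rfl⟩ := v
    have hb : π₁ b = 0 := by simpa [twistMap_apply] using h0
    refine ⟨⟨π₂ a + r • b, ?_⟩, Subtype.ext ?_⟩
    · simp [LinearMap.mem_ker, hb]
    · simp [twistMap_apply, hb]
  · rintro ⟨c, rfl⟩
    rfl
  · obtain ⟨b, rfl⟩ := h₁ y
    exact ⟨⟨_, (0, b), rfl⟩, by simp [twistMap_apply]⟩

end Extension

/-! ### The distinguished element of the twisted extension. -/

section Construction

variable {R Q S : Type u} [CommRing R] [IsLocalRing R]
  [CommRing Q] [IsLocalRing Q] [Algebra R Q]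
  [CommRing S] [IsLocalRing S] {I : Ideal S} {θ : Q →+* S ⧸ I}

/-- If `w` lies over `ker Φ`, is congruent to `a` times a basis vector modulo `xs`, and some
functional vanishing on `ker Φ` maps the basis into `𝔪` and this basis vector to `r`, then `w` is
a minimal generator. -/
theorem notMem_maximalIdeal_smul_top (hI : I ≠ ⊤) (hθ : Function.Surjective θ)
    (hm : (maximalIdeal R).map (algebraMap R Q) = maximalIdeal Q)
    {ι : Type*} {W P : Type u} [Fintype ι] [DecidableEq ι] [AddCommGroup W] [Module R W]
    [AddCommGroup P] [Module R P]
    (B : Module.Basis ι R P) (i : W →ₗ[R] P) (γ : P →ₗ[R] R) (hγi : γ ∘ₗ i = 0)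
    (hγ : ∀ k, γ (B k) ∈ maximalIdeal R) {j : ι} {a : Q} {s a' : S}
    (hs : s ∈ maximalIdeal S) (hsr : Ideal.Quotient.mk I s = θ (algebraMap R Q (γ (B j))))
    (ha' : Ideal.Quotient.mk I a' = θ a) (hsa : s * a' ∉ maximalIdeal S * I)
    {J : Ideal Q} (hJ : ∀ q ∈ J, θ q = 0) {w : Q ⊗[R] W}
    (hw : i.baseChange Q w - a • (1 ⊗ₜ[R] B j) ∈ (J • ⊤ : Submodule Q (Q ⊗[R] P))) :
    w ∉ (maximalIdeal Q • ⊤ : Submodule Q (Q ⊗[R] W)) := by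
  intro hwm
  let Bh : Module.Basis ι Q (Q ⊗[R] P) := B.baseChange Q
  let co : (Q ⊗[R] P) →ₗ[Q] (ι → Q) := Bh.equivFun.toLinearMap
  have hcoB (k : ι) : co (1 ⊗ₜ[R] B k) = Pi.single k 1 := by
    have : (1 : Q) ⊗ₜ[R] B k = Bh k := (Module.Basis.baseChange_apply Q B k).symm
    rw [this]
    ext l
    simp [co, Pi.single_apply, eq_comm]
  have hbm (k) : algebraMap R Q (γ (B k)) ∈ maximalIdeal Q := hm ▸ Ideal.mem_map_of_mem _ (hγ k)
  choose c₀ hc₀ hc₀' using fun k => exists_lift_mem_maximalIdeal hI hθ (hbm k)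
  -- At `j` the lift must be `s` itself, as `s * a' ∉ 𝔫 I` is known for this lift.
  let c : ι → S := Function.update c₀ j s
  have hc (k) : c k ∈ maximalIdeal S := by
    rcases eq_or_ne k j with rfl | hk
    · simpa [c] using hs
    · simpa [c, hk] using hc₀ k
  have hc' (k) : Ideal.Quotient.mk I (c k) = θ (algebraMap R Q (γ (B k))) := by
    rcases eq_or_ne k j with rfl | hk
    · simpa [c] using hsr
    · simpa [c, hk] using hc₀' k
  let T : Submodule Q (ι → Q) := LinearMap.range (co ∘ₗ i.baseChange Q)
  have hT : ∀ u ∈ T, ∑ k, algebraMap R Q (γ (B k)) * u k = 0 := by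
    rintro _ ⟨v, rfl⟩
    have h1 (y : Q ⊗[R] P) : ∑ k, algebraMap R Q (γ (B k)) * co y k =
        TensorProduct.AlgebraTensorModule.rid R Q Q (γ.baseChange Q y) := by
      let φ : (Q ⊗[R] P) →ₗ[Q] Q :=
        ∑ k, algebraMap R Q (γ (B k)) • (LinearMap.proj k ∘ₗ co)
      let ψ : (Q ⊗[R] P) →ₗ[Q] Q :=
        (TensorProduct.AlgebraTensorModule.rid R Q Q).toLinearMap ∘ₗ γ.baseChange Q
      have : φ = ψ := by
        refine Bh.ext fun k => ?_
        rw [show Bh k = 1 ⊗ₜ[R] B k from Module.Basis.baseChange_apply Q B k]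
        simp [φ, ψ, hcoB, Pi.single_apply, Algebra.smul_def]
      have := DFunLike.congr_fun this y
      simpa [φ, ψ, Algebra.smul_def] using this
    rw [LinearMap.comp_apply, h1]
    rw [← LinearMap.comp_apply (γ.baseChange Q), ← LinearMap.baseChange_comp, hγi,
      LinearMap.baseChange_zero, LinearMap.zero_apply, map_zero]
  have hv : co (i.baseChange Q w) ∈ maximalIdeal Q • T := by
    have := Submodule.mem_map_of_mem (f := co ∘ₗ i.baseChange Q) hwm
    rwa [map_smul'', Submodule.map_top] at this
  have hlift (k) : Ideal.Quotient.mk I ((Pi.single j a' : ι → S) k) =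
      θ (co (i.baseChange Q w) k) := by
    have h1 : (LinearMap.proj k : (ι → Q) →ₗ[Q] Q) (co (i.baseChange Q w - a • (1 ⊗ₜ[R] B j))) ∈
        (J • ⊤ : Submodule Q Q) :=
      apply_mem_smul_top (LinearMap.proj k ∘ₗ co) hw
    rw [smul_eq_mul, Ideal.mul_top] at h1
    have h2 := hJ _ h1
    rw [map_sub, map_smul, hcoB, LinearMap.proj_apply, Pi.sub_apply, map_sub, sub_eq_zero] at h2
    rw [h2]
    rcases eq_or_ne k j with rfl | hk
    · simpa using ha'
    · simp [hk]
  have := sum_mul_mem_of_mem_smul hI hθ hc hc' hT hv hlift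
  rw [Finset.sum_eq_single j (fun k _ hk => by simp [hk]) (by simp)] at this
  exact hsa (by simpa [c] using this)

theorem smul_mem_smul_top_of_mul_mem {Q U : Type*} [CommRing Q] [AddCommGroup U] [Module Q U]
    {J J' : Ideal Q} {a : Q} (ha : ∀ z ∈ J', a * z ∈ J) {u : U}
    (hu : u ∈ (J' • ⊤ : Submodule Q U)) : a • u ∈ (J • ⊤ : Submodule Q U) := by
  induction hu using Submodule.smul_induction_on' with
  | smul z hz n _ =>
    rw [smul_smul]
    exact smul_mem_smul (ha z hz) trivial
  | add x _ y _ hx hy =>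
    rw [smul_add]
    exact add_mem hx hy

variable [Module.Flat R Q]

/-- Solving for an element of `ker (twistMap π₁ π₂ r)` over a basis vector, modulo `xs`. -/
theorem exists_baseChange_ker_twistMap
    (hm : (maximalIdeal R).map (algebraMap R Q) = maximalIdeal Q)
    {H G F N : Type u} [AddCommGroup H] [Module R H] [AddCommGroup G] [Module R G]
    [AddCommGroup F] [Module R F] [AddCommGroup N] [Module R N]
    {π₀ : F →ₗ[R] N} {π₁ : G →ₗ[R] π₀.ker} {π₂ : H →ₗ[R] π₁.ker} {r : R}
    (h₀ : Function.Surjective π₀) (h₁ : Function.Surjective π₁) (h₂ : Function.Surjective π₂)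
    (hmin : ∀ v ∈ π₀.ker, v ∈ (maximalIdeal R • ⊤ : Submodule R F))
    {xs : List Q} (hN : IsWeaklyRegular (Q ⊗[R] N) xs)
    (hK : IsWeaklyRegular (Q ⊗[R] π₀.ker) xs)
    {a : Q} (ha : ∀ z ∈ maximalIdeal Q, a * z ∈ Ideal.ofList xs)
    (hr : algebraMap R Q r ∈ maximalIdeal Q) (e : G) :
    ∃ w : Q ⊗[R] (twistMap π₁ π₂ r).ker,
      (twistMap π₁ π₂ r).ker.subtype.baseChange Q w - a • (1 ⊗ₜ[R] ((0, e) : H × G)) ∈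
        (Ideal.ofList xs • ⊤ : Submodule Q (Q ⊗[R] (H × G))) := by
  -- By minimality `π₁ e ∈ 𝔪 F`, so `a` takes it into `(xs) F`; regularity on `N` brings this back
  -- to `(xs) K`.
  have hK₁ : a • (1 ⊗ₜ[R] π₁ e) ∈ (Ideal.ofList xs • ⊤ : Submodule Q (Q ⊗[R] π₀.ker)) := by
    refine hN.mem_smul_top_of_exact
      (LinearMap.baseChange_injective_of_flat Q π₀.ker.injective_subtype)
      (LinearMap.baseChange_exact_of_flat Q π₀.exact_subtype_ker_map)
      (LinearMap.baseChange_surjective Q h₀) ?_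
    rw [map_smul, LinearMap.baseChange_tmul]
    refine smul_mem_smul_top_of_mul_mem ha ?_
    rw [← hm]
    exact TensorProduct.tmul_mem_smul_top 1 (hmin _ (π₁ e).2)
  obtain ⟨g, hg, hge⟩ := exists_mem_smul_top_of_surjective
    (LinearMap.baseChange_surjective Q h₁) hK₁
  obtain ⟨l, hl⟩ := (LinearMap.baseChange_exact_of_flat Q π₁.exact_subtype_ker_map
    (a • (1 ⊗ₜ[R] e) - g)).1 (by
      rw [map_sub, hge, map_smul, LinearMap.baseChange_tmul, sub_self])
  -- Here `r l = r a e - r g` lies in `(xs) G`, and regularity on `K` brings it back to `(xs) L`.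
  have hrl : r • l ∈ (Ideal.ofList xs • ⊤ : Submodule Q (Q ⊗[R] π₁.ker)) := by
    refine hK.mem_smul_top_of_exact
      (LinearMap.baseChange_injective_of_flat Q π₁.ker.injective_subtype)
      (LinearMap.baseChange_exact_of_flat Q π₁.exact_subtype_ker_map)
      (LinearMap.baseChange_surjective Q h₁) ?_
    rw [← algebraMap_smul Q r l, map_smul, hl, smul_sub, smul_smul]
    refine sub_mem (smul_mem_smul ?_ trivial) (Submodule.smul_mem _ _ hg)
    rw [mul_comm]
    exact ha _ hr
  obtain ⟨p, hp, hpl⟩ := exists_mem_smul_top_of_surjective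
    (LinearMap.baseChange_surjective Q h₂) hrl
  let w₀ : Q ⊗[R] (H × G) := (LinearMap.inr R H G).baseChange Q (a • (1 ⊗ₜ[R] e) - g) -
    (LinearMap.inl R H G).baseChange Q p
  have hinl : twistMap π₁ π₂ r ∘ₗ LinearMap.inl R H G =
      LinearMap.inl R G π₀.ker ∘ₗ π₁.ker.subtype ∘ₗ π₂ := by
    ext v <;> simp [twistMap_apply]
  have hinr : twistMap π₁ π₂ r ∘ₗ LinearMap.inr R H G ∘ₗ π₁.ker.subtype =
      LinearMap.inl R G π₀.ker ∘ₗ π₁.ker.subtype ∘ₗ (r • LinearMap.id) := by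
    ext v <;> simp [twistMap_apply]
  have hw₀ : (twistMap π₁ π₂ r).baseChange Q w₀ = 0 := by
    have h1 : (twistMap π₁ π₂ r).baseChange Q ((LinearMap.inl R H G).baseChange Q p) =
        (LinearMap.inl R G π₀.ker).baseChange Q (π₁.ker.subtype.baseChange Q (r • l)) := by
      rw [← LinearMap.comp_apply, ← LinearMap.baseChange_comp, hinl, LinearMap.baseChange_comp,
        LinearMap.baseChange_comp, LinearMap.comp_apply, LinearMap.comp_apply, hpl]
    have h2 : (twistMap π₁ π₂ r).baseChange Q ((LinearMap.inr R H G).baseChange Q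
        (a • (1 ⊗ₜ[R] e) - g)) =
        (LinearMap.inl R G π₀.ker).baseChange Q (π₁.ker.subtype.baseChange Q (r • l)) := by
      rw [← hl]
      simp only [← LinearMap.comp_apply, ← LinearMap.baseChange_comp]
      rw [hinr]
      simp only [LinearMap.baseChange_comp, LinearMap.comp_apply, LinearMap.baseChange_smul,
        LinearMap.baseChange_id, LinearMap.smul_apply, LinearMap.id_apply]
    rw [map_sub, h1, h2, sub_self]
  obtain ⟨w, hw⟩ := (LinearMap.baseChange_exact_of_flat Q
    (twistMap π₁ π₂ r).exact_subtype_ker_map w₀).1 hw₀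
  refine ⟨w, ?_⟩
  have h3 : w₀ - a • (1 ⊗ₜ[R] ((0, e) : H × G)) =
      -((LinearMap.inr R H G).baseChange Q g + (LinearMap.inl R H G).baseChange Q p) := by
    simp only [w₀, map_sub, map_smul, LinearMap.baseChange_tmul, LinearMap.inr_apply]
    abel
  rw [hw, h3]
  exact neg_mem (add_mem (apply_mem_smul_top _ hg) (apply_mem_smul_top _ hp))

end Construction

/-! ### Assembling the proof. -/

section Main

theorem LinearMap.exact_ker_subtype_rangeRestrict {R A B : Type*} [CommRing R] [AddCommGroup A]
    [Module R A] [AddCommGroup B] [Module R B] (f : A →ₗ[R] B) :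
    Function.Exact f.ker.subtype f.rangeRestrict := by
  rw [LinearMap.exact_iff, LinearMap.ker_rangeRestrict, Submodule.range_subtype]

variable {R Q : Type u} [CommRing R] [CommRing Q] [Algebra R Q] [Module.Flat R Q]

theorem RingTheory.Sequence.IsWeaklyRegular.ker_baseChange {xs : List Q}
    (hQ : IsWeaklyRegular Q xs) {F N : Type*} [AddCommGroup F] [Module R F] [Module.Flat R F]
    [AddCommGroup N] [Module R N] {π : F →ₗ[R] N} (hπ : Function.Surjective π)
    (hN : IsWeaklyRegular (Q ⊗[R] N) xs) : IsWeaklyRegular (Q ⊗[R] π.ker) xs :=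
  hQ.module_of_flat.of_exact_left hN
    (LinearMap.baseChange_injective_of_flat Q π.ker.injective_subtype)
    (LinearMap.baseChange_exact_of_flat Q π.exact_subtype_ker_map)
    (LinearMap.baseChange_surjective Q hπ)

theorem RingTheory.Sequence.IsWeaklyRegular.ker_baseChange_append {xs : List Q} {x : Q}
    (hQ : IsWeaklyRegular Q (xs ++ [x])) {F N : Type*} [AddCommGroup F] [Module R F]
    [Module.Flat R F] [AddCommGroup N] [Module R N] {π : F →ₗ[R] N} (hπ : Function.Surjective π)
    (hN : IsWeaklyRegular (Q ⊗[R] N) xs) : IsWeaklyRegular (Q ⊗[R] π.ker) (xs ++ [x]) :=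
  (hQ.module_of_flat (M := Q ⊗[R] F)).append_singleton_of_exact hN
    (LinearMap.baseChange_injective_of_flat Q π.ker.injective_subtype)
    (LinearMap.baseChange_exact_of_flat Q π.exact_subtype_ker_map)
    (LinearMap.baseChange_surjective Q hπ)

variable [IsLocalRing R] [IsLocalRing Q]

theorem HasSocleGenerator.ker_twistMap
    {S : Type u} [CommRing S] [IsLocalRing S] {I : Ideal S} {θ : Q →+* S ⧸ I}
    (hI : I ≠ ⊤) (hθ : Function.Surjective θ)
    (hm : (maximalIdeal R).map (algebraMap R Q) = maximalIdeal Q)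
    {xs : List Q} (hker : ∀ q, θ q = 0 ↔ q ∈ Ideal.ofList xs)
    {N F G H : Type u} [AddCommGroup N] [Module R N] [AddCommGroup F] [Module R F]
    [AddCommGroup G] [Module R G] [AddCommGroup H] [Module R H]
    (hN : IsWeaklyRegular (Q ⊗[R] N) xs)
    {π₀ : F →ₗ[R] N} {π₁ : G →ₗ[R] π₀.ker} {π₂ : H →ₗ[R] π₁.ker} {ι₁ ι₂ : Type*} [Fintype ι₁]
    [Fintype ι₂] [DecidableEq ι₁] [DecidableEq ι₂] (B₁ : Module.Basis ι₁ R G)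
    (B₂ : Module.Basis ι₂ R H)
    (h₀ : Function.Surjective π₀) (h₁ : Function.Surjective π₁) (h₂ : Function.Surjective π₂)
    (hmin₀ : ∀ v ∈ π₀.ker, v ∈ (maximalIdeal R • ⊤ : Submodule R F))
    (hmin₁ : ∀ v, π₁ v = 0 → ∀ i, B₁.repr v i ∈ maximalIdeal R)
    {r : R} (hr : algebraMap R Q r ∈ maximalIdeal Q) (hrm : r ∈ maximalIdeal R)
    (hK : IsWeaklyRegular (Q ⊗[R] π₀.ker) xs)
    (hD : IsWeaklyRegular (Q ⊗[R] (twistMap π₁ π₂ r).range) xs)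
    {s a' : S} (hs : s ∈ maximalIdeal S)
    (hsr : Ideal.Quotient.mk I s = θ (algebraMap R Q r))
    (ha' : ∀ z ∈ maximalIdeal S, a' * z ∈ I) (hsa : s * a' ∉ maximalIdeal S * I) (j : ι₁) :
    HasSocleGenerator (Q ⊗[R] (twistMap π₁ π₂ r).ker) xs := by
  obtain ⟨a, ha⟩ := hθ (Ideal.Quotient.mk I a')
  have haz : ∀ z ∈ maximalIdeal Q, a * z ∈ Ideal.ofList xs := by
    intro z hz
    obtain ⟨z', hz', hzz⟩ := exists_lift_mem_maximalIdeal hI hθ hz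
    rw [← hker, map_mul, ha, ← hzz, ← map_mul, Ideal.Quotient.eq_zero_iff_mem]
    exact ha' z' hz'
  obtain ⟨w, hw⟩ := exists_baseChange_ker_twistMap (π₂ := π₂) hm h₀ h₁ h₂ hmin₀ hN hK haz hr (B₁ j)
  refine ⟨w, fun z hz => ?_, ?_⟩
  -- Since `z a ∈ (xs)`, the image of `z w` lies in `(xs) (H × G)`; regularity on the image of the
  -- twisted map brings it back to the kernel.
  · refine hD.mem_smul_top_of_exact
      (LinearMap.baseChange_injective_of_flat Q (twistMap π₁ π₂ r).ker.injective_subtype)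
      (LinearMap.baseChange_exact_of_flat Q (twistMap π₁ π₂ r).exact_ker_subtype_rangeRestrict)
      (LinearMap.baseChange_surjective Q (twistMap π₁ π₂ r).surjective_rangeRestrict) ?_
    have h1 := Submodule.smul_mem _ z hw
    rw [smul_sub, smul_smul] at h1
    have h2 : (z * a) • (1 ⊗ₜ[R] ((0, B₁ j) : H × G)) ∈
        (Ideal.ofList xs • ⊤ : Submodule Q (Q ⊗[R] (H × G))) :=
      smul_mem_smul (mul_comm a z ▸ haz z hz) trivial
    have h3 := add_mem h1 h2
    rw [sub_add_cancel] at h3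
    rw [map_smul]
    exact h3
  -- Its coefficients lie in `𝔪`: on `H` because the cover `π₁` is minimal, on `G` because of the
  -- factor `r`.
  · let γ : H × G →ₗ[R] R := B₁.coord j ∘ₗ LinearMap.fst R _ _ ∘ₗ twistMap π₁ π₂ r
    have hγ (v : H × G) : γ v = B₁.repr (π₂ v.1) j + r * B₁.repr v.2 j := by
      simp [γ, twistMap_apply]
    have hB : (B₂.prod B₁) (Sum.inr j) = (0, B₁ j) := by simp
    have hγj : γ ((B₂.prod B₁) (Sum.inr j)) = r := by simp [hγ]
    refine notMem_maximalIdeal_smul_top hI hθ hm (B₂.prod B₁)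
      (twistMap π₁ π₂ r).ker.subtype γ ?_
      (fun k => ?_) (j := Sum.inr j) hs (a := a) ?_ ha.symm hsa
      (fun q hq => (hker q).2 hq) (w := w) ?_
    · ext v
      simp only [γ, LinearMap.comp_apply, Submodule.subtype_apply, LinearMap.mem_ker.1 v.2,
        map_zero, LinearMap.zero_apply]
    · rw [hγ]
      refine add_mem ?_ (Ideal.mul_mem_right _ _ hrm)
      exact hmin₁ _ (π₂ _).2 j
    · rw [hγj, hsr]
    · rw [hB]
      exact hw

variable [IsNoetherianRing R]

/-- From a non-projective module on which the sequence `xs` is regular one builds a module that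
has the residue field as a direct summand modulo `xs`. -/
theorem IsResolving.exists_hasSocleGenerator {X : ObjectProperty (ModuleCat.{u} R)}
    (hX : IsResolving X) {S : Type u} [CommRing S] [IsLocalRing S] {I : Ideal S}
    {θ : Q →+* S ⧸ I} (hI : IsBurchIdeal I) (hθ : Function.Surjective θ)
    (hm : (maximalIdeal R).map (algebraMap R Q) = maximalIdeal Q)
    (happ : ∀ q : Q, ∃ r : R, q - algebraMap R Q r ∈ maximalIdeal Q ^ 2)
    {xs : List Q} (hker : ∀ q, θ q = 0 ↔ q ∈ Ideal.ofList xs) (hQ : IsWeaklyRegular Q xs)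
    {N : Type u} [AddCommGroup N] [Module R N] [Module.Finite R N] (hNX : X (.of R N))
    (hNp : ¬ Module.Projective R N) (hN : IsWeaklyRegular (Q ⊗[R] N) xs) :
    ∃ (W : Type u) (_ : AddCommGroup W) (_ : Module R W), Module.Finite R W ∧ X (.of R W) ∧
      IsWeaklyRegular (Q ⊗[R] W) xs ∧ HasSocleGenerator (Q ⊗[R] W) xs := by
  obtain ⟨F, _, _, n₀, B₀, π₀, h₀, hmin₀⟩ := exists_minimal_cover (R := R) N
  have := Module.Finite.of_basis B₀
  have := Module.Projective.of_basis B₀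
  obtain ⟨G, _, _, n₁, B₁, π₁, h₁, hmin₁⟩ := exists_minimal_cover (R := R) π₀.ker
  have := Module.Finite.of_basis B₁
  have := Module.Projective.of_basis B₁
  obtain ⟨H, _, _, n₂, B₂, π₂, h₂, -⟩ := exists_minimal_cover (R := R) π₁.ker
  have := Module.Finite.of_basis B₂
  have := Module.Projective.of_basis B₂
  obtain ⟨r, hr, s, hs, hsr, a', ha', hsa⟩ := hI.exists_mul_notMem_of_dense hθ happ
  have hrm : r ∈ maximalIdeal R := by
    by_contra hu
    have hu : IsUnit r := by simpa using hu
    exact hr (hu.map _)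
  -- The construction needs a basis vector of `G`; if `G = 0`, then `N ≅ F` would be free.
  have hn₁ : 0 < n₁ := by
    rw [Nat.pos_iff_ne_zero]
    rintro rfl
    apply hNp
    have : Subsingleton G := B₁.repr.toEquiv.subsingleton
    have hsub : Subsingleton π₀.ker := h₁.subsingleton
    have hinj : Function.Injective π₀ := by
      rw [← LinearMap.ker_eq_bot]
      exact (Submodule.subsingleton_iff_eq_bot).1 hsub
    exact Module.Projective.of_equiv (LinearEquiv.ofBijective π₀ ⟨hinj, h₀⟩)
  have hKX := hX.ker_of_surjective h₀ hX.projective hNX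
  have hLX := hX.ker_of_surjective h₁ hX.projective hKX
  have hLX' := hX.ker_of_surjective h₂ hX.projective hLX
  have hK := hQ.ker_baseChange h₀ hN
  have hL := hQ.ker_baseChange h₁ hK
  obtain ⟨f, g, hf, hfg, hg⟩ := exists_exact_range_twistMap π₁ π₂ r h₁ h₂
  have hD : IsWeaklyRegular (Q ⊗[R] (twistMap π₁ π₂ r).range) xs :=
    hL.of_exact hK (LinearMap.baseChange_injective_of_flat Q hf)
      (LinearMap.baseChange_exact_of_flat Q hfg) (LinearMap.baseChange_surjective Q hg)
  have hW : IsWeaklyRegular (Q ⊗[R] (twistMap π₁ π₂ r).ker) xs :=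
    hQ.module_of_flat.of_exact_left hD
      (LinearMap.baseChange_injective_of_flat Q (twistMap π₁ π₂ r).ker.injective_subtype)
      (LinearMap.baseChange_exact_of_flat Q (twistMap π₁ π₂ r).exact_ker_subtype_rangeRestrict)
      (LinearMap.baseChange_surjective Q (twistMap π₁ π₂ r).surjective_rangeRestrict)
  exact ⟨(twistMap π₁ π₂ r).ker, _, _, inferInstance, hX.ker_twistMap h₂ hLX hLX', hW,
    .ker_twistMap hI.ne_top hθ hm hker hN B₁ B₂ h₀ h₁ h₂
      (fun v hv => B₀.mem_smul_top_of_repr_mem (hmin₀ v hv)) hmin₁ hr hrm hK hD hs hsr ha' hsa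
      ⟨0, hn₁⟩⟩

/-- The kernel of a surjection from a projective module onto a module of infinite projective
dimension has infinite projective dimension. -/
theorem projectiveDimension_ker_eq_top {R : Type u} [CommRing R] {P N : Type u} [AddCommGroup P]
    [Module R P] [Module.Projective R P] [AddCommGroup N] [Module R N] {π : P →ₗ[R] N}
    (hπ : Function.Surjective π) (hN : projectiveDimension (ModuleCat.of R N) = ⊤) :
    projectiveDimension (ModuleCat.of R π.ker) = ⊤ := by
  by_contra hcon
  obtain ⟨n, hn⟩ := (projectiveDimension_ne_top_iff _).1 hcon
  refine (projectiveDimension_ne_top_iff _).2 ⟨n + 1, ?_⟩ hN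
  have hproj : Projective (ModuleCat.of R P) :=
    (IsProjective.iff_projective P).1 ‹_›
  exact (LinearMap.shortExact_shortComplexKer hπ).hasProjectiveDimensionLT_X₃ (n + 1) hn
    (hasProjectiveDimensionLT_of_ge _ 1 _ (by omega))

end Main

theorem mainTheorem6 (R : Type u) [CommRing R] [IsLocalRing R] [IsNoetherianRing R]
    (hR : IsBurchRing R) (t : ℕ) (ht : localDepth R = (t : ℕ∞))
    (M : ModuleCat.{u} R) (hfin : Module.Finite R M) (hM : projectiveDimension M = ⊤) :
    resolvingClosure M (syzygy t (ModuleCat.of R (ResidueField R))) := by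
  intro X hX hXM
  obtain ⟨xs, hreg, -, hlen, S, _, _, I, hI, ⟨e⟩⟩ := hR
  have hlen : xs.length = t := by
    rw [ht] at hlen
    exact_mod_cast hlen
  have hm : (maximalIdeal R).map (algebraMap R (LocalCompletion R)) =
      maximalIdeal (LocalCompletion R) := AdicCompletion.maximalIdeal_eq_map.symm
  have hQ := hreg.toIsWeaklyRegular
  have hxs : ∀ x ∈ xs, x ∈ maximalIdeal (LocalCompletion R) := by
    have hne : Ideal.ofList xs ≠ ⊤ := by
      intro h
      apply hreg.top_ne_smul
      rw [h, top_smul]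
    exact fun x hx => le_maximalIdeal hne (Ideal.subset_span hx)
  -- Each syzygy makes one more member of `xs` regular, so `t` syzygies suffice.
  have key (i : ℕ) (hi : i ≤ xs.length) : ∃ (N : Type u) (_ : AddCommGroup N) (_ : Module R N),
      Module.Finite R N ∧ X (.of R N) ∧ projectiveDimension (ModuleCat.of R N) = ⊤ ∧
        IsWeaklyRegular (LocalCompletion R ⊗[R] N) (xs.take i) := by
    induction i with
    | zero => exact ⟨M, _, _, hfin, hXM, hM, .nil _ _⟩
    | succ i ih =>
      obtain ⟨N, _, _, hNf, hNX, hNd, hN⟩ := ih (by omega)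
      obtain ⟨n, p, hp⟩ := Module.Finite.exists_fin' R N
      refine ⟨p.ker, _, _, inferInstance, hX.ker_of_surjective hp hX.projective hNX,
        projectiveDimension_ker_eq_top hp hNd, ?_⟩
      rw [← List.take_concat_get' xs i hi]
      have h1 : IsWeaklyRegular (LocalCompletion R) (xs.take i ++ [xs[i]]) := by
        rw [List.take_concat_get' xs i hi]
        rw [← List.take_append_drop (i + 1) xs] at hQ
        exact hQ.of_append_left
      exact h1.ker_baseChange_append hp hN
  obtain ⟨N, _, _, hNf, hNX, hNd, hN⟩ := key xs.length le_rfl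
  rw [List.take_length] at hN
  have hNp : ¬ Module.Projective R N := by
    intro h
    have : Projective (ModuleCat.of R N) := (IsProjective.iff_projective N).1 h
    exact (projectiveDimension_ne_top_iff (ModuleCat.of R N)).2 ⟨0, inferInstance⟩ hNd
  let θ : LocalCompletion R →+* S ⧸ I :=
    (e : _ →+* S ⧸ I).comp (Ideal.Quotient.mk (Ideal.ofList xs))
  have hθ : Function.Surjective θ := e.surjective.comp Ideal.Quotient.mk_surjective
  have hker (q) : θ q = 0 ↔ q ∈ Ideal.ofList xs := by
    rw [← Ideal.Quotient.eq_zero_iff_mem]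
    exact map_eq_zero_iff e e.injective
  obtain ⟨W, _, _, _, hWX, hWreg, hWsoc⟩ := hX.exists_hasSocleGenerator hI hθ hm
    (fun q => LocalCompletion.exists_sub_mem_pow q 2) hker hQ hNX hNp hN
  exact hX.syzygy_residueField hm LocalCompletion.exists_sub_mem_pow t hWX xs hlen hxs hWreg hWsoc
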